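/- Let $R$ be a commutative ring with identity and a fixed invertible element $q^{1/2}$ such that $\alpha=q+q^{-1}$ is invertible, and put $\beta=\alpha^{-1}$. Let $\Sigma=\Sigma_{0,n+1}$ be a disk in the plane with punctures $\mathsf p_k=(k,0)$, $k=1,\dots,n$, and let $\mathcal S_n=\mathcal S(\Sigma;R)$ be its Kauffman bracket skein algebra: the $R$-module generated by isotopy classes of (possibly empty) framed links in $\Sigma\times(0,1)$ modulo the relations $L_\times=q^{1/2}L_\infty+q^{-1/2}L_0$ (where $L_\infty$ joins the two regions swept out when the over-strand is turned counterclockwise) and $L\sqcup\bigcirc=-(q+q^{-1})L$, with product $L_1L_2$ given by placing $L_1$ above $L_2$, and unit the empty link. For distinct $i_1,\dots,i_r$ let $t_{i_1\cdots i_r}\in\mathcal S_n$ be the simple closed curve (with vertical framing) that encloses exactly $\mathsf p_{i_1},\dots,\mathsf p_{i_r}$ and passes below every other puncture lying between them. Put $$s_{ij}=t_{ij}+\beta t_it_j\ (i\ne j),\qquad s_{ii}=\alpha-\beta t_i^2,$$ $$s_{ijk}=t_{ijk}+\beta(t_it_{jk}+t_jt_{ik}+t_kt_{ij})+2\beta^2t_it_jt_k\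 \ (i,j,k\text{ distinct}).$$ Say that $(i_1,\dots,i_m)$, with entries in $\{1,\dots,n\}$, is in cyclic order if it is a cyclic rotation of a strictly increasing sequence. Then the following hold in $\mathcal S_n$. (a) For $(i_1,i_2,i_3,i_4,i_5)$ in cyclic order, $$q^2s_{i_1i_5}s_{i_2i_3i_4}-s_{i_2i_5}s_{i_1i_3i_4}+s_{i_3i_5}s_{i_1i_2i_4}-q^{-2}s_{i_4i_5}s_{i_1i_2i_3}=(q-q^{-1})\big(q^{-1}s_{i_1i_2}s_{i_3i_4i_5}+q\,s_{i_3i_4}s_{i_1i_2i_5}\big).$$ (b) For $(i_1,i_2,i_3,i_4)$ in cyclic order, $$q^2s_{i_1i_2}s_{i_1i_3i_4}-s_{i_1i_3}s_{i_1i_2i_4}+q^{-2}s_{i_1i_4}s_{i_1i_2i_3}-(q^2+q^{-2}-1)s_{i_1i_1}s_{i_2i_3i_4}$$ $$=(q-q^{-1})^2\beta\,t_{i_1}\big(s_{i_1i_3}s_{i_2i_4}-q^2s_{i_1i_2}s_{i_3i_4}-q^{-2}s_{i_1i_4}s_{i_2i_3}\big).$$ (c) If $q^2=1$ in $R$, then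 the classical type II relations hold: for all $1\le c\le n$ and $1\le a_1<a_2<a_3<a_4\le n$, $$s_{a_1c}s_{a_2a_3a_4}-s_{a_2c}s_{a_1a_3a_4}+s_{a_3c}s_{a_1a_2a_4}-s_{a_4c}s_{a_1a_2a_3}=0.$$ -/

import Mathlib

/-!
# The Kauffman bracket skein algebra of the `n`-punctured disk

`Σ = Σ_{0,n+1}` is a disk in the plane with the punctures `p_k = (k, 0)`, `1 ≤ k ≤ n` (here indexed
by `Fin n`). Framed links in `Σ × (0,1)` are presented by link diagrams on `Σ` (vertical framing),
modulo planar isotopy of `Σ` and the framed Reidemeister moves. A diagram in general position is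
recorded by sweeping it with a vertical line from left to right: the line meets the diagram in
finitely many strands, numbered `0, 1, 2, …` from bottom to top, and passes one elementary event
(a `Slice`) at a time.
-/

namespace Skein

/-- The elementary events met by the sweeping line.
* `cup`: a local minimum of the `x`-coordinate; two new strands appear.
* `cap`: a local maximum of the `x`-coordinate; two adjacent strands are joined and disappear.
* `cross risingOver`: two adjacent strands cross, the lower one rising and the upper one descending;
  the rising strand is the over-strand iff `risingOver = true`.
* `puncture`: the line passes a puncture of the surface. -/
inductive Kind : Type
  | cup : Kind
  | cap : Kind
  | cross (risingOver : Bool) : Kind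
  | puncture : Kind
  deriving DecidableEq

/-- Number of strands entering an event from the left. -/
def Kind.ins : Kind → ℕ
  | .cup => 0
  | .cap => 2
  | .cross _ => 2
  | .puncture => 0

/-- Number of strands leaving an event to the right. -/
def Kind.outs : Kind → ℕ
  | .cup => 2
  | .cap => 0
  | .cross _ => 2
  | .puncture => 0

/-- An event together with its height: `pos` is the number of strands that pass below it. -/
structure Slice : Type where
  kind : Kind
  pos : ℕ
  deriving DecidableEq

def cup (i : ℕ) : Slice := ⟨.cup, i⟩
def cap (i : ℕ) : Slice := ⟨.cap, i⟩
def cross (risingOver : Bool) (i : ℕ) : Slice := ⟨.cross risingOver, i⟩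
def puncture (i : ℕ) : Slice := ⟨.puncture, i⟩

/-- `Closes m w`: starting from `m` strands, the events of `w` can be performed one after the other
and no strand is left at the end. -/
def Closes : ℕ → List Slice → Prop
  | m, [] => m = 0
  | m, s :: w => s.pos + s.kind.ins ≤ m ∧ Closes (m - s.kind.ins + s.kind.outs) w

/-- A (possibly empty) link diagram on the disk with `n` punctures: a sequence of events that starts
and ends with no strands and passes exactly `n` punctures. The `k`-th puncture event is the
puncture `p_k`. -/
@[ext] structure LinkDiagram (n : ℕ) : Type where
  word : List Slice
  closes : Closes 0 word
  punctures : word.countP (fun s => s.kind = Kind.puncture) = n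

/-- The local moves generating isotopy of framed links in `Σ × (0,1)`. -/
inductive LocalMove : List Slice → List Slice → Prop
  /-- Planar isotopy: two consecutive events at different heights are interchanged (`g` is the lower
  one, `d` is the number of strands between them). Two punctures are never interchanged. -/
  | exchange (g h : Kind) (i d : ℕ) (hgh : ¬ (g = Kind.puncture ∧ h = Kind.puncture)) :
      LocalMove [⟨g, i⟩, ⟨h, i + g.outs + d⟩] [⟨h, i + g.ins + d⟩, ⟨g, i⟩]
  /-- Planar isotopy: straightening a zigzag. -/
  | zigzag (i : ℕ) : LocalMove [cup i, cap (i + 1)] []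
  | zigzag' (i : ℕ) : LocalMove [cup (i + 1), cap i] []
  /-- Planar isotopy: rotating a crossing past a local extremum. -/
  | rotateCup (f : Bool) (i : ℕ) :
      LocalMove [cup i, cross f (i + 1)] [cup (i + 1), cross (!f) i]
  | rotateCap (f : Bool) (i : ℕ) :
      LocalMove [cross f (i + 1), cap i] [cross (!f) i, cap (i + 1)]
  /-- Framed Reidemeister move I: a curl may be replaced by the curl of the same sign on the other
  side of the strand. -/
  | reidemeister₁ (f : Bool) (i : ℕ) :
      LocalMove [cup (i + 1), cross f i, cap (i + 1)] [cup i, cross f (i + 1), cap i]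
  /-- Reidemeister move II. -/
  | reidemeister₂ (f : Bool) (i : ℕ) : LocalMove [cross f i, cross (!f) i] []
  /-- Reidemeister move III. With the three strands `a, b, c` from bottom to top on the left,
  `f₁, f₂, f₃` say whether `a` is over `b`, `a` is over `c`, `b` is over `c`; the hypothesis says
  that the three strands lie at three linearly ordered levels. -/
  | reidemeister₃ (f₁ f₂ f₃ : Bool) (i : ℕ) (hf : f₁ = f₃ → f₂ = f₁) :
      LocalMove [cross f₁ i, cross f₂ (i + 1), cross f₃ i]
        [cross f₃ (i + 1), cross f₂ i, cross f₁ (i + 1)]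

/-- `Superposed c w₁ w₂ w`: the sequence of events `w` is obtained by drawing `w₁` above `w₂`. Here
`c` lists the strands at the present position of the sweeping line from bottom to top, with `true`
for the strands of `w₁` and `false` for those of `w₂`. Wherever a strand of `w₁` crosses a strand of
`w₂`, the former is the over-strand; the puncture events are shared. -/
inductive Superposed : List Bool → List Slice → List Slice → List Slice → Prop
  | nil : Superposed [] [] [] []
  /-- an event of the upper link -/
  | upper (a b : List Bool) (k : Kind) (hk : k ≠ Kind.puncture) (w₁ w₂ w : List Slice) :
      Superposed (a ++ List.replicate k.outs true ++ b) w₁ w₂ w →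
      Superposed (a ++ List.replicate k.ins true ++ b)
        (⟨k, a.count true⟩ :: w₁) w₂ (⟨k, a.length⟩ :: w)
  /-- an event of the lower link -/
  | lower (a b : List Bool) (k : Kind) (hk : k ≠ Kind.puncture) (w₁ w₂ w : List Slice) :
      Superposed (a ++ List.replicate k.outs false ++ b) w₁ w₂ w →
      Superposed (a ++ List.replicate k.ins false ++ b)
        w₁ (⟨k, a.count false⟩ :: w₂) (⟨k, a.length⟩ :: w)
  /-- a puncture -/
  | puncture (a b : List Bool) (w₁ w₂ w : List Slice) :
      Superposed (a ++ b) w₁ w₂ w →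
      Superposed (a ++ b) (puncture (a.count true) :: w₁) (puncture (a.count false) :: w₂)
        (puncture a.length :: w)
  /-- a rising strand of the upper link crosses over a descending strand of the lower link -/
  | upperRises (a b : List Bool) (w₁ w₂ w : List Slice) :
      Superposed (a ++ [false, true] ++ b) w₁ w₂ w →
      Superposed (a ++ [true, false] ++ b) w₁ w₂ (cross true a.length :: w)
  /-- a descending strand of the upper link crosses over a rising strand of the lower link -/
  | lowerRises (a b : List Bool) (w₁ w₂ w : List Slice) :
      Superposed (a ++ [true, false] ++ b) w₁ w₂ w →
      Superposed (a ++ [false, true] ++ b) w₁ w₂ (cross false a.length :: w)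

section Algebra

variable (R : Type*) [CommRing R] (A : Rˣ) (n : ℕ)

/-- The defining relations of the skein algebra, where `A = q^{1/2}`: the generators are the link
diagrams; isotopic framed links are identified; the skein relation
`[crossing] = q^{1/2} [∞-resolution] + q^{-1/2} [0-resolution]` (the `∞`-resolution joins the two
regions swept by turning the over-strand counterclockwise) and `[L ⊔ trivial circle] = -(q+q⁻¹) [L]`
hold; the empty link is `1`; and the product `L₁ L₂` is the link obtained by placing `L₁` above
`L₂`. -/
inductive Rel : FreeAlgebra R (LinkDiagram n) → FreeAlgebra R (LinkDiagram n) → Prop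
  | isotopy (D D' : LinkDiagram n) (u v x y : List Slice) (hxy : LocalMove x y)
      (hD : D.word = u ++ x ++ v) (hD' : D'.word = u ++ y ++ v) :
      Rel (FreeAlgebra.ι R D) (FreeAlgebra.ι R D')
  /-- rising over-strand: the `∞`-resolution is a cap followed by a cup -/
  | skeinRising (D D₁ D₂ : LinkDiagram n) (u v : List Slice) (i : ℕ)
      (hD : D.word = u ++ [cross true i] ++ v)
      (hD₁ : D₁.word = u ++ [cap i, cup i] ++ v) (hD₂ : D₂.word = u ++ v) :
      Rel (FreeAlgebra.ι R D)
        ((A : R) • FreeAlgebra.ι R D₁ + ((A⁻¹ : Rˣ) : R) • FreeAlgebra.ι R D₂)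
  /-- descending over-strand: the `∞`-resolution consists of two parallel horizontal strands -/
  | skeinDescending (D D₁ D₂ : LinkDiagram n) (u v : List Slice) (i : ℕ)
      (hD : D.word = u ++ [cross false i] ++ v)
      (hD₁ : D₁.word = u ++ v) (hD₂ : D₂.word = u ++ [cap i, cup i] ++ v) :
      Rel (FreeAlgebra.ι R D)
        ((A : R) • FreeAlgebra.ι R D₁ + ((A⁻¹ : Rˣ) : R) • FreeAlgebra.ι R D₂)
  | circle (D D' : LinkDiagram n) (u v : List Slice) (i : ℕ)
      (hD : D.word = u ++ [cup i, cap i] ++ v) (hD' : D'.word = u ++ v) :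
      Rel (FreeAlgebra.ι R D)
        ((-((A : R) ^ 2 + ((A⁻¹ : Rˣ) : R) ^ 2)) • FreeAlgebra.ι R D')
  | empty (D : LinkDiagram n) (hD : D.word = List.replicate n (puncture 0)) :
      Rel (FreeAlgebra.ι R D) 1
  | stack (D₁ D₂ D : LinkDiagram n) (h : Superposed [] D₁.word D₂.word D.word) :
      Rel (FreeAlgebra.ι R D₁ * FreeAlgebra.ι R D₂) (FreeAlgebra.ι R D)

/-- The Kauffman bracket skein algebra `S(Σ_{0,n+1}; R)` with respect to `A = q^{1/2}`. -/
abbrev SkeinAlgebra : Type _ := RingQuot (Rel R A n)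

end Algebra

/-- The number of strands lying below the puncture `p_k` in the curve `t_I`: the curve consists of
two strands between its extreme punctures; it encloses `p_k` if `k ∈ I`, and otherwise both strands
pass below `p_k`, so that the curve avoids the vertical ray going up from `p_k`. -/
def strandsBelow {n : ℕ} (I : Finset (Fin n)) (k : Fin n) : ℕ :=
  if k ∈ I then 1 else if (∃ a ∈ I, a < k) ∧ (∃ b ∈ I, k < b) then 2 else 0

/-- The part of the curve `t_I` near the line `x = k`. -/
def curveAt {n : ℕ} (I : Finset (Fin n)) (k : Fin n) : List Slice :=
  (if k ∈ I ∧ ∀ a ∈ I, k ≤ a then [cup 0] else []) ++ [puncture (strandsBelow I k)] ++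
    (if k ∈ I ∧ ∀ a ∈ I, a ≤ k then [cap 0] else [])

theorem closes_curve {n : ℕ} (I : Finset (Fin n)) (l : List (Fin n)) (hl : l.Pairwise (· < ·))
    (hlow : ∀ a, a ∉ l → ∀ b ∈ l, a < b) :
    Closes (if (∃ a ∈ I, a ∉ l) ∧ (∃ b ∈ I, b ∈ l) then 2 else 0) (l.flatMap (curveAt I)) := by
  induction l with
  | nil => simp [Closes]
  | cons k l ih =>
    have hkl : ∀ b ∈ l, k < b := (List.pairwise_cons.1 hl).1
    have ih' := ih (List.pairwise_cons.1 hl).2 (by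
      intro a ha b hb
      by_cases hak : a = k
      · exact hak ▸ hkl b hb
      · exact hlow a (by simp [hak, ha]) b (by simp [hb]))
    have hout : ∀ a, a ∉ k :: l ↔ a < k := fun a =>
      ⟨fun h => hlow a h k (by simp), fun h h' => by
        rcases List.mem_cons.1 h' with h'' | h''
        · exact absurd h (by simp [h''])
        · exact lt_asymm h (hkl a h'')⟩
    have hin : ∀ b, b ∈ l ↔ k < b := fun b =>
      ⟨hkl b, fun h => by
        by_contra hb
        have : b < k := (hout b).1 (by simp [hb, h.ne'])
        exact lt_asymm h this⟩
    have e1 : (∃ a ∈ I, a ∉ l) ↔ ((∃ a ∈ I, a < k) ∨ k ∈ I) := by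
      constructor
      · rintro ⟨a, ha, h⟩
        rw [hin, not_lt] at h
        rcases h.lt_or_eq with h | h
        · exact Or.inl ⟨a, ha, h⟩
        · exact Or.inr (h ▸ ha)
      · rintro (⟨a, ha, h⟩ | h)
        · exact ⟨a, ha, by rw [hin]; exact lt_asymm h⟩
        · exact ⟨k, h, by rw [hin]; exact lt_irrefl k⟩
    have e2 : (∃ b ∈ I, b ∈ k :: l) ↔ (k ∈ I ∨ ∃ b ∈ I, k < b) := by
      constructor
      · rintro ⟨b, hb, h⟩
        rcases List.mem_cons.1 h with h | h
        · exact Or.inl (h ▸ hb)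
        · exact Or.inr ⟨b, hb, (hin b).1 h⟩
      · rintro (h | ⟨b, hb, h⟩)
        · exact ⟨k, h, by simp⟩
        · exact ⟨b, hb, by simp [(hin b).2 h]⟩
    have e3 : (∀ a ∈ I, k ≤ a) ↔ ¬ ∃ a ∈ I, a < k := by push Not; rfl
    have e4 : (∀ a ∈ I, a ≤ k) ↔ ¬ ∃ b ∈ I, k < b := by push Not; rfl
    simp only [e1] at ih'
    simp only [hin] at ih'
    rw [List.flatMap_cons]
    simp only [hout, e2, curveAt, strandsBelow, e3, e4]
    by_cases hp : ∃ a ∈ I, a < k <;> by_cases hs : ∃ b ∈ I, k < b <;> by_cases hm : k ∈ I <;>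
      simp only [hp, hs, hm] at ih' ⊢ <;>
      simpa [Closes, cup, cap, puncture, Kind.ins, Kind.outs] using ih'

theorem countP_curve {n : ℕ} (I : Finset (Fin n)) (l : List (Fin n)) :
    (l.flatMap (curveAt I)).countP (fun s => s.kind = Kind.puncture) = l.length := by
  induction l with
  | nil => rfl
  | cons k l ih =>
    rw [List.flatMap_cons, List.countP_append, ih, List.length_cons, add_comm]
    congr 1
    unfold curveAt
    split_ifs <;> simp [cup, cap, puncture]

/-- The simple closed curve that is the outer boundary of the subsurface `Σ(I)`, for nonempty `I`
(for `I = ∅` this is the empty link). -/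
def curve {n : ℕ} (I : Finset (Fin n)) : LinkDiagram n where
  word := (List.finRange n).flatMap (curveAt I)
  closes := by
    have h := closes_curve I (List.finRange n) (List.pairwise_lt_finRange n) (by simp)
    simpa using h
  punctures := by rw [countP_curve, List.length_finRange]

section Elements

variable {R : Type*} [CommRing R] (A : Rˣ) (β : R) {n : ℕ}

/-- The element `t_I` of the skein algebra; `t_{i_1 ⋯ i_r}` is `t A {i_1, …, i_r}`. -/
def t (I : Finset (Fin n)) : SkeinAlgebra R A n :=
  RingQuot.mkAlgHom R (Rel R A n) (FreeAlgebra.ι R (curve I))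

/-- `s_{ij} = t_{ij} + β t_i t_j` for `i ≠ j`, and `s_{ii} = α - β t_i²`, where `α = q + q⁻¹`,
`q = A²` (and `β = α⁻¹`). -/
def s₂ (i j : Fin n) : SkeinAlgebra R A n :=
  if i = j then algebraMap R _ ((A : R) ^ 2 + ((A⁻¹ : Rˣ) : R) ^ 2) - β • t A {i} ^ 2
  else t A {i, j} + β • (t A {i} * t A {j})

/-- `s_{ijk} = t_{ijk} + β (t_i t_{jk} + t_j t_{ik} + t_k t_{ij}) + 2 β² t_i t_j t_k`,
for distinct `i, j, k`. -/
def s₃ (i j k : Fin n) : SkeinAlgebra R A n :=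
  t A {i, j, k} + β • (t A {i} * t A {j, k} + t A {j} * t A {i, k} + t A {k} * t A {i, j})
    + (2 * β ^ 2) • (t A {i} * t A {j} * t A {k})

end Elements

/-- `(i_1, …, i_m)` is in cyclic order: it is a cyclic rotation of a strictly increasing tuple. -/
def CyclicOrder {m n : ℕ} (i : Fin m → Fin n) : Prop :=
  ∃ a : Fin m → Fin n, StrictMono a ∧ ∃ v : ℕ, i = a ∘ ⇑(finRotate m ^ v)

end Skein

namespace Skein

/-! ### Words and their values -/

/-! Each instance of the two quantum relations involves at most five punctures. Multiplying by `α³`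
clears `β`: what remains is an identity between products of curves `t_I` whose coefficients are
integral Laurent polynomials in `A`. On the disk with exactly five (or four) punctures it can be
checked mechanically: draw one diagram above the other, resolve all crossings by the skein relation,
simplify the resulting crossingless diagrams by planar isotopies, replace trivial circles by `-(A² +
A⁻²)`, and observe that all coefficients cancel. Only soundness is needed, namely that each
operation on words preserves the element of the skein algebra (`Simplify.bracket_eq`,
`Combination.eval_mul`, `Expression.eval_normalize`). That the simplified words are linearly
independent, or even canonical, plays no role. The computations are `Expression.fiveIndex_isZero`
and `Expression.fourIndex_isZero`, one for each cyclic rotation; since they are formal in `A`, they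
hold over every `R`.

The passage to `n` punctures is functorial. Adding a puncture above all strands of every diagram
respects isotopy, skein relations and stacking, so it defines a homomorphism of skein algebras. As
`t_I` runs below the punctures it does not enclose, this homomorphism sends `t_I` to the curve
around the relabelled punctures. Iterating gives a homomorphism for every increasing map of
punctures (`exists_algHom`), and the relations are transported along it.

If `q² = 1`, then `q = q⁻¹`, both right-hand sides vanish and all surviving coefficients are `±1`.
The five-index relation then gives the classical one when `c` differs from all `a_j`, and the
four-index relation gives it when `c` is one of them. The symmetries of `s_{ij}` and `s_{ijk}`,
which follow from the commutation of the `t_i`, bring the terms into the required order. -/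

/-- The number of punctures passed by a word. -/
def punctureCount (w : List Slice) : ℕ := w.countP (fun s => s.kind = Kind.puncture)

@[simp] theorem punctureCount_nil : punctureCount [] = 0 := rfl

@[simp] theorem punctureCount_append (u v : List Slice) :
    punctureCount (u ++ v) = punctureCount u + punctureCount v := List.countP_append

theorem punctureCount_cons (s : Slice) (w : List Slice) :
    punctureCount (s :: w) = (if s.kind = Kind.puncture then 1 else 0) + punctureCount w := by
  simp [punctureCount, List.countP_cons, add_comm]

/-- The number of strands on the right of a word entered by `m` strands. -/
def width (m : ℕ) (w : List Slice) : ℕ := w.foldl (fun m s => m - s.kind.ins + s.kind.outs) m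

/-- The events of a word can be performed starting from `m` strands. -/
def Fits : ℕ → List Slice → Prop
  | _, [] => True
  | m, s :: w => s.pos + s.kind.ins ≤ m ∧ Fits (m - s.kind.ins + s.kind.outs) w

theorem closes_append {m : ℕ} {u v : List Slice} :
    Closes m (u ++ v) ↔ Fits m u ∧ Closes (width m u) v := by
  induction u generalizing m with
  | nil => simp [Fits, width]
  | cons s u ih => simp [Closes, Fits, width, ih, and_assoc]

/-- Every event changes the number of strands by a fixed amount and none are left at the end, so the
remaining word determines how many strands enter it. This is how the height of an inserted puncture
is computed later. -/
theorem Closes.unique {w : List Slice} {m m' : ℕ} (h : Closes m w) (h' : Closes m' w) :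
    m = m' := by
  induction w generalizing m m' with
  | nil => exact h.trans h'.symm
  | cons s w ih =>
    have := ih h.2 h'.2
    have h1 := h.1
    have h2 := h'.1
    omega

/-! ### The defining relations of the skein algebra as identities between words. -/

section Bracket

variable (R : Type*) [CommRing R] (A : Rˣ) (n : ℕ)

open Classical in
/-- The element of the skein algebra presented by a word (zero if the word is not a diagram). -/
noncomputable def bracket (w : List Slice) : SkeinAlgebra R A n :=
  if h : Closes 0 w ∧ punctureCount w = n then
    RingQuot.mkAlgHom R (Rel R A n) (FreeAlgebra.ι R ⟨w, h.1, h.2⟩)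
  else 0

variable {R A n}

theorem bracket_word (D : LinkDiagram n) :
    bracket R A n D.word = RingQuot.mkAlgHom R (Rel R A n) (FreeAlgebra.ι R D) := by
  rw [bracket, dif_pos ⟨D.closes, D.punctures⟩]

theorem bracket_of_count_ne {w : List Slice} (h : punctureCount w ≠ n) :
    bracket R A n w = 0 := dif_neg fun h' => h h'.2

theorem bracket_of_valid {w : List Slice} (h : Closes 0 w) (h' : punctureCount w = n) :
    bracket R A n w = RingQuot.mkAlgHom R (Rel R A n) (FreeAlgebra.ι R ⟨w, h, h'⟩) :=
  dif_pos ⟨h, h'⟩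

theorem bracket_localMove {u v x y : List Slice} (hxy : LocalMove x y)
    (hx : Closes 0 (u ++ x ++ v)) (hy : Closes 0 (u ++ y ++ v))
    (hc : punctureCount x = punctureCount y) :
    bracket R A n (u ++ x ++ v) = bracket R A n (u ++ y ++ v) := by
  by_cases hn : punctureCount (u ++ x ++ v) = n
  · have hn' : punctureCount (u ++ y ++ v) = n := by simpa [hc] using hn
    rw [bracket_of_valid hx hn, bracket_of_valid hy hn']
    exact RingQuot.mkAlgHom_rel R (.isotopy _ _ u v x y hxy rfl rfl)
  · have hn' : punctureCount (u ++ y ++ v) ≠ n := by simpa [hc] using hn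
    rw [bracket_of_count_ne hn, bracket_of_count_ne hn']

theorem closes_smoothing {m i : ℕ} {f : Bool} {u v : List Slice}
    (h : Closes m (u ++ cross f i :: v)) :
    Closes m (u ++ cap i :: cup i :: v) ∧ Closes m (u ++ v) := by
  rw [closes_append] at h
  obtain ⟨hu, h1, h2⟩ := h
  simp only [cross, Kind.ins, Kind.outs] at h1 h2
  have e : width m u - 2 + 2 = width m u := by omega
  rw [e] at h2
  constructor
  · rw [closes_append]
    refine ⟨hu, h1, ?_, ?_⟩
    · simp only [cup, cap, Kind.ins, Kind.outs]; omega
    · simpa only [cup, cap, Kind.ins, Kind.outs, Nat.add_zero, Nat.sub_zero, e] using h2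
  · exact closes_append.2 ⟨hu, h2⟩

/-- Merges the two skein relations: changing the over-strand exchanges the roles of the resolutions,
hence inverts both powers of `A`. -/
theorem bracket_cross {i : ℕ} {f : Bool} {u v : List Slice}
    (h : Closes 0 (u ++ cross f i :: v)) :
    bracket R A n (u ++ cross f i :: v) =
      ((A ^ (if f then 1 else -1 : ℤ) : Rˣ) : R) • bracket R A n (u ++ cap i :: cup i :: v) +
      ((A ^ (if f then -1 else 1 : ℤ) : Rˣ) : R) • bracket R A n (u ++ v) := by
  obtain ⟨h1, h2⟩ := closes_smoothing h
  have e1 : punctureCount (u ++ cap i :: cup i :: v) = punctureCount (u ++ cross f i :: v) := by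
    simp [punctureCount_cons, cap, cup, cross]
  have e2 : punctureCount (u ++ v) = punctureCount (u ++ cross f i :: v) := by
    simp [punctureCount_cons, cross]
  by_cases hn : punctureCount (u ++ cross f i :: v) = n
  · rw [bracket_of_valid h hn, bracket_of_valid h1 (e1.trans hn), bracket_of_valid h2 (e2.trans hn),
      ← map_smul, ← map_smul, ← map_add]
    cases f
    · rw [add_comm]
      simpa using RingQuot.mkAlgHom_rel R
        (Rel.skeinDescending (A := A) ⟨_, h, hn⟩ ⟨_, h2, e2.trans hn⟩ ⟨_, h1, e1.trans hn⟩ u v i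
          (by simp) rfl (by simp))
    · simpa using RingQuot.mkAlgHom_rel R
        (Rel.skeinRising (A := A) ⟨_, h, hn⟩ ⟨_, h1, e1.trans hn⟩ ⟨_, h2, e2.trans hn⟩ u v i
          (by simp) (by simp) rfl)
  · rw [bracket_of_count_ne hn, bracket_of_count_ne (e1 ▸ hn), bracket_of_count_ne (e2 ▸ hn)]
    simp

theorem bracket_circle {i : ℕ} {u v : List Slice} (h : Closes 0 (u ++ cup i :: cap i :: v))
    (h' : Closes 0 (u ++ v)) :
    bracket R A n (u ++ cup i :: cap i :: v) =
      (-((A : R) ^ 2 + ((A⁻¹ : Rˣ) : R) ^ 2)) • bracket R A n (u ++ v) := by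
  have e : punctureCount (u ++ v) = punctureCount (u ++ cup i :: cap i :: v) := by
    simp [punctureCount_cons, cap, cup]
  by_cases hn : punctureCount (u ++ cup i :: cap i :: v) = n
  · rw [bracket_of_valid h hn, bracket_of_valid h' (e.trans hn), ← map_smul]
    exact RingQuot.mkAlgHom_rel R
      (Rel.circle (A := A) ⟨_, h, hn⟩ ⟨_, h', e.trans hn⟩ u v i (by simp) rfl)
  · rw [bracket_of_count_ne hn, bracket_of_count_ne (e ▸ hn), smul_zero]

theorem bracket_empty : bracket R A n (List.replicate n (puncture 0)) = 1 := by
  have h : Closes 0 (List.replicate n (puncture 0)) := by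
    induction n with
    | zero => rfl
    | succ n ih => exact ⟨le_rfl, ih⟩
  have hn : punctureCount (List.replicate n (puncture 0)) = n := by
    simp [punctureCount, puncture, List.countP_replicate]
  rw [bracket_of_valid h hn, ← map_one (RingQuot.mkAlgHom R (Rel R A n))]
  exact RingQuot.mkAlgHom_rel R (.empty _ rfl)

theorem Superposed.closes {c : List Bool} {w₁ w₂ w : List Slice} (h : Superposed c w₁ w₂ w) :
    Closes (c.count true) w₁ ∧ Closes (c.count false) w₂ ∧ Closes c.length w := by
  induction h with
  | nil => exact ⟨rfl, rfl, rfl⟩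
  | upper a b k hk w₁ w₂ w _ ih =>
    simp only [List.count_append, List.count_replicate, List.length_append,
      List.length_replicate] at ih ⊢
    refine ⟨⟨by simp, ?_⟩, by simpa using ih.2.1, ⟨by simp, ?_⟩⟩
    · convert ih.1 using 1; simp; omega
    · convert ih.2.2 using 1; simp; omega
  | lower a b k hk w₁ w₂ w _ ih =>
    simp only [List.count_append, List.count_replicate, List.length_append,
      List.length_replicate] at ih ⊢
    refine ⟨by simpa using ih.1, ⟨by simp, ?_⟩, ⟨by simp, ?_⟩⟩
    · convert ih.2.1 using 1; simp; omega
    · convert ih.2.2 using 1; simp; omega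
  | puncture a b w₁ w₂ w _ ih =>
    exact ⟨⟨by simp [Skein.puncture, Kind.ins], ih.1⟩,
      ⟨by simp [Skein.puncture, Kind.ins], ih.2.1⟩, ⟨by simp [Skein.puncture, Kind.ins], ih.2.2⟩⟩
  | upperRises a b w₁ w₂ w _ ih =>
    simp only [List.count_append, List.length_append] at ih ⊢
    refine ⟨by simpa using ih.1, by simpa using ih.2.1, ⟨by simp [cross, Kind.ins], ?_⟩⟩
    convert ih.2.2 using 1; simp [cross, Kind.ins, Kind.outs]; omega
  | lowerRises a b w₁ w₂ w _ ih =>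
    simp only [List.count_append, List.length_append] at ih ⊢
    refine ⟨by simpa using ih.1, by simpa using ih.2.1, ⟨by simp [cross, Kind.ins], ?_⟩⟩
    convert ih.2.2 using 1; simp [cross, Kind.ins, Kind.outs]; omega

theorem Superposed.punctureCount {c : List Bool} {w₁ w₂ w : List Slice}
    (h : Superposed c w₁ w₂ w) :
    punctureCount w₁ = punctureCount w ∧ punctureCount w₂ = punctureCount w := by
  induction h with
  | nil => exact ⟨rfl, rfl⟩
  | upper a b k hk w₁ w₂ w _ ih => simpa [punctureCount_cons, hk] using ih
  | lower a b k hk w₁ w₂ w _ ih => simpa [punctureCount_cons, hk] using ih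
  | puncture a b w₁ w₂ w _ ih => simpa [punctureCount_cons, Skein.puncture] using ih
  | upperRises a b w₁ w₂ w _ ih => simpa [punctureCount_cons, cross] using ih
  | lowerRises a b w₁ w₂ w _ ih => simpa [punctureCount_cons, cross] using ih

theorem bracket_mul {w₁ w₂ w : List Slice} (h : Superposed [] w₁ w₂ w) :
    bracket R A n w₁ * bracket R A n w₂ = bracket R A n w := by
  obtain ⟨h1, h2, h3⟩ := h.closes
  obtain ⟨c1, c2⟩ := h.punctureCount
  by_cases hn : Skein.punctureCount w = n
  · rw [bracket_of_valid h1 (c1.trans hn), bracket_of_valid h2 (c2.trans hn),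
      bracket_of_valid h3 hn, ← map_mul]
    exact RingQuot.mkAlgHom_rel R (.stack _ _ _ h)
  · rw [bracket_of_count_ne (c1 ▸ hn), bracket_of_count_ne hn, zero_mul]

end Bracket

/-! ### Simplification of words -/

/-- The isotopies used to simplify words. -/
inductive Shrink : List Slice → List Slice → Prop
  | exchange (g h : Kind) (i d : ℕ) (hgh : ¬ (g = Kind.puncture ∧ h = Kind.puncture)) :
      Shrink [⟨g, i⟩, ⟨h, i + g.outs + d⟩] [⟨h, i + g.ins + d⟩, ⟨g, i⟩]
  | exchange' (g h : Kind) (i d : ℕ) (hgh : ¬ (g = Kind.puncture ∧ h = Kind.puncture)) :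
      Shrink [⟨h, i + g.ins + d⟩, ⟨g, i⟩] [⟨g, i⟩, ⟨h, i + g.outs + d⟩]
  | zigzag (i : ℕ) : Shrink [cup i, cap (i + 1)] []
  | zigzag' (i : ℕ) : Shrink [cup (i + 1), cap i] []
  | cancel (f : Bool) (i : ℕ) : Shrink [cross f i, cross (!f) i] []

theorem Shrink.localMove {x y : List Slice} (h : Shrink x y) : LocalMove x y ∨ LocalMove y x := by
  cases h with
  | exchange g h i d hgh => exact .inl (.exchange g h i d hgh)
  | exchange' g h i d hgh => exact .inr (.exchange g h i d hgh)
  | zigzag i => exact .inl (.zigzag i)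
  | zigzag' i => exact .inl (.zigzag' i)
  | cancel f i => exact .inl (.reidemeister₂ f i)

theorem Shrink.punctureCount {x y : List Slice} (h : Shrink x y) :
    punctureCount x = punctureCount y := by
  cases h <;> simp [punctureCount_cons, cup, cap, cross, add_comm]

/-- Validity is propagated only towards the simplified word. The converse fails, since a removed
zigzag or pair of crossings leaves no bound on its height. -/
theorem Shrink.closes {x y : List Slice} (h : Shrink x y) {m : ℕ} {v : List Slice}
    (hx : Closes m (x ++ v)) : Closes m (y ++ v) := by
  cases h with
  | exchange g h i d hgh =>
    obtain ⟨h1, h2, h3⟩ := hx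
    simp only at h1 h2 h3
    refine ⟨?_, ?_, ?_⟩
    · simp only; omega
    · simp only; omega
    · convert h3 using 1; simp only; omega
  | exchange' g h i d hgh =>
    obtain ⟨h1, h2, h3⟩ := hx
    simp only at h1 h2 h3
    refine ⟨?_, ?_, ?_⟩
    · simp only; omega
    · simp only; omega
    · convert h3 using 1; simp only; omega
  | zigzag i => simpa [Closes, cup, cap, Kind.ins, Kind.outs] using hx.2.2
  | zigzag' i => simpa [Closes, cup, cap, Kind.ins, Kind.outs] using hx.2.2
  | cancel f i =>
    obtain ⟨h1, h2, h3⟩ := hx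
    simp only [cross, Kind.ins, Kind.outs] at h1 h2 h3
    rwa [show m - 2 + 2 - 2 + 2 = m by omega] at h3

/-- `Simplify w c w'`: the word `w` can be transformed into `w'` by isotopies and by removing `c`
trivial circles. -/
inductive Simplify : List Slice → ℕ → List Slice → Prop
  | refl (w : List Slice) : Simplify w 0 w
  | trans {w w' w'' : List Slice} {c d : ℕ} :
      Simplify w c w' → Simplify w' d w'' → Simplify w (c + d) w''
  | shrink (u v : List Slice) {x y : List Slice} : Shrink x y →
      Simplify (u ++ x ++ v) 0 (u ++ y ++ v)
  | circle (u v : List Slice) (i : ℕ) : Simplify (u ++ cup i :: cap i :: v) 1 (u ++ v)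

namespace Simplify

theorem head {x y v w : List Slice} {c : ℕ} (h : Shrink x y) (h' : Simplify (y ++ v) c w) :
    Simplify (x ++ v) c w := by
  simpa using (shrink [] v h).trans h'

theorem cons (s : Slice) {w w' : List Slice} {c : ℕ} (h : Simplify w c w') :
    Simplify (s :: w) c (s :: w') := by
  induction h with
  | refl w => exact refl _
  | trans _ _ h h' => exact h.trans h'
  | shrink u v h => exact shrink (s :: u) v h
  | circle u v i => exact circle (s :: u) v i

theorem closes {w w' : List Slice} {c : ℕ} (h : Simplify w c w') : Closes 0 w → Closes 0 w' := by
  induction h with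
  | refl w => exact id
  | trans _ _ h h' => exact h' ∘ h
  | shrink u v h =>
    simp only [List.append_assoc, closes_append (u := u)]
    exact And.imp_right h.closes
  | circle u v i =>
    simp only [closes_append (u := u)]
    rintro ⟨hu, -, -, h⟩
    exact ⟨hu, by simpa [cup, cap, Kind.ins, Kind.outs] using h⟩

theorem bracket_eq {R : Type*} [CommRing R] {A : Rˣ} {n : ℕ} {w w' : List Slice} {c : ℕ}
    (h : Simplify w c w') : Closes 0 w →
      bracket R A n w = (-((A : R) ^ 2 + ((A⁻¹ : Rˣ) : R) ^ 2)) ^ c • bracket R A n w' := by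
  induction h with
  | refl w => simp
  | trans h h' ih ih' =>
    intro hw
    rw [ih hw, ih' (h.closes hw), smul_smul, pow_add]
  | shrink u v h =>
    intro hw
    have hw' := (shrink u v h).closes hw
    rw [pow_zero, one_smul]
    rcases h.localMove with h' | h'
    · exact bracket_localMove h' hw hw' h.punctureCount
    · exact (bracket_localMove h' hw' hw h.punctureCount.symm).symm
  | circle u v i =>
    intro hw
    rw [pow_one]
    exact bracket_circle hw ((circle u v i).closes hw)

end Simplify

/-! ### Reflection in a vertical line -/

/-- The reflection of an elementary event in a vertical line. -/
def Kind.mirror : Kind → Kind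
  | .cup => .cap
  | .cap => .cup
  | .cross f => .cross f
  | .puncture => .puncture

/-- The reflection of a word in a vertical line (up to crossing changes). -/
def mirror (w : List Slice) : List Slice := (w.map fun s => ⟨s.kind.mirror, s.pos⟩).reverse

theorem Kind.mirror_mirror (k : Kind) : k.mirror.mirror = k := by cases k <;> rfl

theorem mirror_mirror (w : List Slice) : mirror (mirror w) = w := by
  simp [mirror, Function.comp_def, Kind.mirror_mirror]

theorem mirror_append (u v : List Slice) : mirror (u ++ v) = mirror v ++ mirror u := by
  simp [mirror]

theorem Kind.ins_mirror (k : Kind) : k.mirror.ins = k.outs := by cases k <;> rfl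

theorem Kind.outs_mirror (k : Kind) : k.mirror.outs = k.ins := by cases k <;> rfl

theorem Kind.mirror_eq_puncture {k : Kind} : k.mirror = .puncture ↔ k = .puncture := by
  cases k <;> simp [Kind.mirror]

theorem Shrink.mirror {x y : List Slice} (h : Shrink x y) : Shrink (mirror x) (mirror y) := by
  cases h with
  | exchange g h i d hgh =>
    have := Shrink.exchange' g.mirror h.mirror i d (by simpa [Kind.mirror_eq_puncture] using hgh)
    simpa [Skein.mirror, Kind.ins_mirror, Kind.outs_mirror] using this
  | exchange' g h i d hgh =>
    have := Shrink.exchange g.mirror h.mirror i d (by simpa [Kind.mirror_eq_puncture] using hgh)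
    simpa [Skein.mirror, Kind.ins_mirror, Kind.outs_mirror] using this
  | zigzag i => exact .zigzag' i
  | zigzag' i => exact .zigzag i
  | cancel f i =>
    have := Shrink.cancel (!f) i
    rwa [Bool.not_not] at this

/-- The simplifying moves are stable under reflection as moves on words, so caps can be pushed to
the left by pushing cups to the right in the mirror image. The effect of the reflection on brackets
never matters, because the reflection is undone afterwards. -/
theorem Simplify.mirror {w w' : List Slice} {c : ℕ} (h : Simplify w c w') :
    Simplify (mirror w) c (mirror w') := by
  induction h with
  | refl w => exact .refl _
  | trans _ _ h h' => exact h.trans h'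
  | shrink u v h =>
    simpa only [mirror_append, List.append_assoc] using
      Simplify.shrink (Skein.mirror v) (Skein.mirror u) h.mirror
  | circle u v i =>
    simpa [Skein.mirror, cup, cap, Kind.mirror] using
      Simplify.circle (Skein.mirror v) (Skein.mirror u) i

/-! ### Evaluation to literals

The following functions are identities up to currying; evaluating them by call-by-name reduces the
argument to a literal before it is copied. -/

/-- `forceNat m k = k m`. -/
def forceNat {α : Type*} (m : ℕ) (k : ℕ → α) : α :=
  match m with
  | 0 => k 0
  | m + 1 => k (m + 1)

@[simp] theorem forceNat_eq {α : Type*} (m : ℕ) (k : ℕ → α) : forceNat m k = k m := by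
  cases m <;> rfl

/-- `forceInt m k = k m`. -/
def forceInt {α : Type*} (m : ℤ) (k : ℤ → α) : α :=
  match m with
  | .ofNat m => forceNat m fun m => k (.ofNat m)
  | .negSucc m => forceNat m fun m => k (.negSucc m)

@[simp] theorem forceInt_eq {α : Type*} (m : ℤ) (k : ℤ → α) : forceInt m k = k m := by
  cases m <;> simp [forceInt]

/-- `forceSlice s k = k s`. -/
def forceSlice {α : Type*} (s : Slice) (k : Slice → α) : α :=
  forceNat s.pos fun p =>
    match s.kind with
    | .cup => k (cup p)
    | .cap => k (cap p)
    | .puncture => k (puncture p)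
    | .cross true => k (cross true p)
    | .cross false => k (cross false p)

@[simp] theorem forceSlice_eq {α : Type*} (s : Slice) (k : Slice → α) : forceSlice s k = k s := by
  obtain ⟨_ | _ | (_ | _) | _, p⟩ := s <;> simp [forceSlice, cup, cap, cross, puncture]

/-- `forceWord w k = k w`. -/
def forceWord {α : Type*} : List Slice → (List Slice → α) → α
  | [], k => k []
  | s :: w, k => forceSlice s fun s => forceWord w fun w => k (s :: w)

@[simp] theorem forceWord_eq {α : Type*} (w : List Slice) (k : List Slice → α) :
    forceWord w k = k w := by
  induction w generalizing k with
  | nil => rfl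
  | cons s w ih => simp [forceWord, ih]

/-- A numerical code for events. -/
def Slice.code (s : Slice) : ℕ :=
  match s.kind with
  | .cup => 5 * s.pos
  | .cap => 5 * s.pos + 1
  | .puncture => 5 * s.pos + 2
  | .cross true => 5 * s.pos + 3
  | .cross false => 5 * s.pos + 4

theorem Slice.code_injective {s s' : Slice} (h : s.code = s'.code) : s = s' := by
  obtain ⟨_ | _ | (_ | _) | _, p⟩ := s <;> obtain ⟨_ | _ | (_ | _) | _, p'⟩ := s' <;>
    simp only [Slice.code] at h <;> first | omega | (congr 1; omega)

/-- Whether two words are equal. -/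
def sameWord : List Slice → List Slice → Bool
  | [], [] => true
  | s :: w, s' :: w' => (s.code).beq s'.code && sameWord w w'
  | _, _ => false

theorem eq_of_sameWord {w w' : List Slice} (h : sameWord w w' = true) : w = w' := by
  induction w generalizing w' with
  | nil => cases w' <;> simp_all [sameWord]
  | cons s w ih =>
    cases w' with
    | nil => simp [sameWord] at h
    | cons s' w' =>
      simp only [sameWord, Bool.and_eq_true] at h
      rw [Slice.code_injective (Nat.eq_of_beq_eq_true h.1), ih h.2]

/-! ### Normalization of words -/

/-- Prepend `cup i` to a word and push it to the right until it embraces a puncture; the number of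
trivial circles removed and the resulting word are passed to `k`. -/
def push {α : Type} : List Slice → ℕ → (ℕ → List Slice → α) → α
  | [], i, k => k 0 [cup i]
  | s :: v, i, k =>
    match s.kind with
    | .puncture =>
      if s.pos = i + 1 then k 0 (cup i :: s :: v)
      else if s.pos ≤ i then push v i fun c w => k c (s :: w)
      else push v i fun c w => k c (puncture (s.pos - 2) :: w)
    | .cup =>
      if s.pos = i + 1 then k 0 (cup i :: s :: v)
      else if s.pos ≤ i then push v (i + 2) fun c w => k c (s :: w)
      else push v i fun c w => k c (cup (s.pos - 2) :: w)
    | .cap =>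
      if s.pos = i then k 1 v
      else if s.pos = i + 1 ∨ s.pos + 1 = i then k 0 v
      else if s.pos ≤ i then push v (i - 2) fun c w => k c (s :: w)
      else push v i fun c w => k c (cap (s.pos - 2) :: w)
    | .cross _ => k 0 (cup i :: s :: v)

/-- The function is in continuation-passing style, so soundness says that one outcome, reached by
legal moves, is passed to every continuation. Nothing is claimed about the shape of the outcome. -/
theorem exists_push (v : List Slice) (i : ℕ) :
    ∃ c w, Simplify (cup i :: v) c w ∧
      ∀ {α : Type} (k : ℕ → List Slice → α), push v i k = k c w := by
  induction v generalizing i with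
  | nil => exact ⟨0, _, .refl _, fun k => rfl⟩
  | cons s v ih =>
    obtain ⟨e, p⟩ := s
    cases e with
    | cross f => exact ⟨0, _, .refl _, fun k => rfl⟩
    | puncture =>
      simp only [push]
      split_ifs with h1 h2
      · exact ⟨0, _, .refl _, fun k => rfl⟩
      · obtain ⟨d, rfl⟩ := Nat.exists_eq_add_of_le h2
        obtain ⟨c, w, h, hk⟩ := ih (p + d)
        exact ⟨c, _, .head (.exchange' .puncture .cup p d (by simp)) (.cons _ h), fun k => hk _⟩
      -- The puncture lies above both new strands; it drops by two heights once the cup is moved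
      -- past it.
      · obtain ⟨d, rfl⟩ := Nat.exists_eq_add_of_le (show i + 2 ≤ p by omega)
        obtain ⟨c, w, h, hk⟩ := ih i
        rw [show i + 2 + d - 2 = i + d by omega]
        exact ⟨c, _, .head (.exchange .cup .puncture i d (by simp)) (h.cons _), fun k => hk _⟩
    | cup =>
      simp only [push]
      split_ifs with h1 h2
      · exact ⟨0, _, .refl _, fun k => rfl⟩
      · obtain ⟨d, rfl⟩ := Nat.exists_eq_add_of_le h2
        obtain ⟨c, w, h, hk⟩ := ih (p + d + 2)
        rw [show p + d + 2 = p + 2 + d by ring] at h hk ⊢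
        exact ⟨c, _, .head (.exchange' .cup .cup p d (by simp)) (.cons _ h), fun k => hk _⟩
      · obtain ⟨d, rfl⟩ := Nat.exists_eq_add_of_le (show i + 2 ≤ p by omega)
        obtain ⟨c, w, h, hk⟩ := ih i
        rw [show i + 2 + d - 2 = i + d by omega]
        exact ⟨c, _, .head (.exchange .cup .cup i d (by simp)) (h.cons _), fun k => hk _⟩
    | cap =>
      simp only [push]
      split_ifs with h1 h2 h3
      · subst h1; exact ⟨1, _, .circle [] v p, fun k => rfl⟩
      · refine ⟨0, v, ?_, fun k => rfl⟩
        rcases h2 with rfl | rfl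
        · exact .head (.zigzag i) (.refl _)
        · exact .head (.zigzag' p) (.refl _)
      · obtain ⟨d, rfl⟩ := Nat.exists_eq_add_of_le (show p + 2 ≤ i by omega)
        obtain ⟨c, w, h, hk⟩ := ih (p + d)
        rw [show p + 2 + d - 2 = p + d by omega]
        exact ⟨c, _, .head (.exchange' .cap .cup p d (by simp)) (.cons _ h), fun k => hk _⟩
      · obtain ⟨d, rfl⟩ := Nat.exists_eq_add_of_le (show i + 2 ≤ p by omega)
        obtain ⟨c, w, h, hk⟩ := ih i
        rw [show i + 2 + d - 2 = i + d by omega]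
        exact ⟨c, _, .head (.exchange .cup .cap i d (by simp)) (h.cons _), fun k => hk _⟩

/-- Push all the cups of a word to the right. -/
def pushCups {α : Type} : List Slice → (ℕ → List Slice → α) → α
  | [], k => k 0 []
  | s :: w, k =>
    pushCups w fun c v =>
      match s.kind with
      | .cup => push v s.pos fun d v => k (c + d) v
      | _ => k c (s :: v)

theorem exists_pushCups (w : List Slice) :
    ∃ c v, Simplify w c v ∧ ∀ {α : Type} (k : ℕ → List Slice → α), pushCups w k = k c v := by
  induction w with
  | nil => exact ⟨0, _, .refl _, fun k => rfl⟩
  | cons s w ih =>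
    obtain ⟨e, p⟩ := s
    obtain ⟨c, v, h, hk⟩ := ih
    simp only [pushCups, hk]
    cases e with
    | cup =>
      obtain ⟨d, v', h', hk'⟩ := exists_push v p
      exact ⟨c + d, v', (h.cons _).trans h', fun k => hk' _⟩
    | _ => exact ⟨c, _, h.cons _, fun k => rfl⟩

/-- Alternately push the cups to the right and the caps to the left, at most `fuel` times; the
number of trivial circles removed and the resulting word are passed to `k`. -/
def tighten {α : Type} : ℕ → List Slice → (ℕ → List Slice → α) → α
  | 0, w, k => k 0 w
  | fuel + 1, w, k =>
    pushCups w fun c v => forceWord v fun v =>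
      pushCups (mirror v) fun d v' => forceWord (mirror v') fun w' =>
        forceNat (c + d) fun c =>
          bif sameWord w w' then k c w' else tighten fuel w' fun d v => k (c + d) v

/-- Stopping early is harmless: whatever word is reached is related to the original one by legal
moves, so no termination argument is needed. -/
theorem exists_tighten (fuel : ℕ) (w : List Slice) :
    ∃ c v, Simplify w c v ∧
      ∀ {α : Type} (k : ℕ → List Slice → α), tighten fuel w k = k c v := by
  induction fuel generalizing w with
  | zero => exact ⟨0, _, .refl _, fun k => rfl⟩
  | succ fuel ih =>
    obtain ⟨c, v, h, hk⟩ := exists_pushCups w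
    obtain ⟨d, v', h', hk'⟩ := exists_pushCups (mirror v)
    have h'' : Simplify w (c + d) (mirror v') := h.trans (by simpa [mirror_mirror] using h'.mirror)
    simp only [tighten, hk, hk', forceWord_eq, forceNat_eq]
    cases sameWord w (mirror v')
    · obtain ⟨b, u, hu, hku⟩ := ih (mirror v')
      exact ⟨c + d + b, u, h''.trans hu, fun k => hku _⟩
    · exact ⟨c + d, _, h'', fun k => rfl⟩

/-- Cancel adjacent pairs of inverse crossings. -/
def cancelCrossings : List Slice → List Slice
  | [] => []
  | s :: w =>
    match s.kind, cancelCrossings w with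
    | .cross f, s' :: v => bif s'.code.beq (cross (!f) s.pos).code then v else s :: s' :: v
    | _, v => s :: v

theorem simplify_cancelCrossings (w : List Slice) : Simplify w 0 (cancelCrossings w) := by
  induction w with
  | nil => exact .refl _
  | cons s w ih =>
    obtain ⟨k, p⟩ := s
    have h := ih.cons ⟨k, p⟩
    simp only [cancelCrossings]
    split
    · rename_i f s' v hv
      rw [hv] at h
      cases hs : s'.code.beq (cross (!f) p).code
      · exact h
      · obtain rfl := Slice.code_injective (Nat.eq_of_beq_eq_true hs)
        exact h.trans (.head (.cancel f p) (.refl v))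
    · exact h

/-! ### Superposition of words -/

/-- An event in the superposition of two words; the number is its height. -/
inductive WeaveStep : Type
  | upper (k : Kind) (j : ℕ)
  | lower (k : Kind) (j : ℕ)
  | puncture (j : ℕ)
  | swap (j : ℕ)

/-- Whether an event is a puncture. -/
def Kind.isPuncture : Kind → Bool
  | .puncture => true
  | _ => false

theorem Kind.ne_of_isPuncture {k : Kind} (h : k.isPuncture = false) : k ≠ .puncture := by
  rintro rfl
  cases h

/-- Remove `m` copies of `b` from the beginning of a list. -/
def stripReplicate (b : Bool) : ℕ → List Bool → Option (List Bool)
  | 0, c => some c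
  | _ + 1, [] => none
  | m + 1, x :: c => bif x == b then stripReplicate b m c else none

theorem eq_of_stripReplicate {b : Bool} {m : ℕ} {c d : List Bool}
    (h : stripReplicate b m c = some d) : c = List.replicate m b ++ d := by
  induction m generalizing c with
  | zero => simpa [stripReplicate] using h
  | succ m ih =>
    cases c with
    | nil => simp [stripReplicate] at h
    | cons x c =>
      simp only [stripReplicate] at h
      cases hx : x == b
      · simp [hx] at h
      · rw [hx] at h
        rw [ih h, List.replicate_succ, List.cons_append, eq_of_beq hx]

/-- `forceBools c k = k c`. -/
def forceBools {α : Type*} : List Bool → (List Bool → α) → α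
  | [], k => k []
  | true :: c, k => forceBools c fun c => k (true :: c)
  | false :: c, k => forceBools c fun c => k (false :: c)

@[simp] theorem forceBools_eq {α : Type*} (c : List Bool) (k : List Bool → α) :
    forceBools c k = k c := by
  induction c generalizing k with
  | nil => rfl
  | cons x c ih => cases x <;> simp [forceBools, ih]

/-- Perform the events of a superposition, starting from strands belonging to the upper (`true`) and
lower (`false`) word; return the upper word, the lower word and their superposition. -/
def weave : List Bool → List WeaveStep → Option (List Slice × List Slice × List Slice)
  | [], [] => some ([], [], [])
  | _ :: _, [] => none
  | c, .upper k j :: l =>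
    match k.isPuncture, stripReplicate true k.ins (c.drop j) with
    | false, some d =>
      (forceBools (c.take j ++ List.replicate k.outs true ++ d) fun c => weave c l).map
        fun r => (⟨k, (c.take j).count true⟩ :: r.1, r.2.1, ⟨k, (c.take j).length⟩ :: r.2.2)
    | _, _ => none
  | c, .lower k j :: l =>
    match k.isPuncture, stripReplicate false k.ins (c.drop j) with
    | false, some d =>
      (forceBools (c.take j ++ List.replicate k.outs false ++ d) fun c => weave c l).map
        fun r => (r.1, ⟨k, (c.take j).count false⟩ :: r.2.1, ⟨k, (c.take j).length⟩ :: r.2.2)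
    | _, _ => none
  | c, .puncture j :: l =>
    (weave c l).map fun r => (puncture ((c.take j).count true) :: r.1,
      puncture ((c.take j).count false) :: r.2.1, puncture (c.take j).length :: r.2.2)
  | c, .swap j :: l =>
    match c.drop j with
    | true :: false :: d =>
      (forceBools (c.take j ++ [false, true] ++ d) fun c => weave c l).map
        fun r => (r.1, r.2.1, cross true (c.take j).length :: r.2.2)
    | false :: true :: d =>
      (forceBools (c.take j ++ [true, false] ++ d) fun c => weave c l).map
        fun r => (r.1, r.2.1, cross false (c.take j).length :: r.2.2)
    | _ => none

theorem superposed_of_weave {c : List Bool} {l : List WeaveStep} {w₁ w₂ w : List Slice}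
    (h : weave c l = some (w₁, w₂, w)) : Superposed c w₁ w₂ w := by
  induction l generalizing c w₁ w₂ w with
  | nil =>
    cases c with
    | nil =>
      simp only [weave, Option.some.injEq, Prod.mk.injEq] at h
      obtain ⟨rfl, rfl, rfl⟩ := h
      exact .nil
    | cons x c => simp [weave] at h
  | cons s l ih =>
    cases s with
    | upper k j =>
      simp only [weave, forceBools_eq] at h
      split at h
      · rename_i d hk hd
        obtain ⟨⟨a, b, e⟩, h', h⟩ := Option.map_eq_some_iff.1 h
        simp only [Prod.mk.injEq] at h
        obtain ⟨rfl, rfl, rfl⟩ := h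
        have := Superposed.upper _ _ k (Kind.ne_of_isPuncture hk) _ _ _ (ih h')
        rwa [List.append_assoc, ← eq_of_stripReplicate hd, List.take_append_drop] at this
      · simp at h
    | lower k j =>
      simp only [weave, forceBools_eq] at h
      split at h
      · rename_i d hk hd
        obtain ⟨⟨a, b, e⟩, h', h⟩ := Option.map_eq_some_iff.1 h
        simp only [Prod.mk.injEq] at h
        obtain ⟨rfl, rfl, rfl⟩ := h
        have := Superposed.lower _ _ k (Kind.ne_of_isPuncture hk) _ _ _ (ih h')
        rwa [List.append_assoc, ← eq_of_stripReplicate hd, List.take_append_drop] at this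
      · simp at h
    | puncture j =>
      simp only [weave] at h
      obtain ⟨⟨a, b, d⟩, h', h⟩ := Option.map_eq_some_iff.1 h
      simp only [Prod.mk.injEq] at h
      obtain ⟨rfl, rfl, rfl⟩ := h
      have := Superposed.puncture (c.take j) (c.drop j) a b d
        (by rw [List.take_append_drop]; exact ih h')
      rwa [List.take_append_drop] at this
    | swap j =>
      simp only [weave, forceBools_eq] at h
      split at h
      · rename_i d hd
        obtain ⟨⟨a, b, e⟩, h', h⟩ := Option.map_eq_some_iff.1 h
        simp only [Prod.mk.injEq] at h
        obtain ⟨rfl, rfl, rfl⟩ := h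
        have := Superposed.upperRises _ _ _ _ _ (ih h')
        rwa [List.append_assoc, show [true, false] ++ d = true :: false :: d from rfl, ← hd,
          List.take_append_drop] at this
      · rename_i d hd
        obtain ⟨⟨a, b, e⟩, h', h⟩ := Option.map_eq_some_iff.1 h
        simp only [Prod.mk.injEq] at h
        obtain ⟨rfl, rfl, rfl⟩ := h
        have := Superposed.lowerRises _ _ _ _ _ (ih h')
        rwa [List.append_assoc, show [false, true] ++ d = false :: true :: d from rfl, ← hd,
          List.take_append_drop] at this
      · simp at h

/-- The crossings that move the lowest `p` of the strands lying above `m` strands below all but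
the lowest `r` of these. -/
def swaps (m r p : ℕ) : List WeaveStep :=
  (List.range p).flatMap fun a => (List.range (m - r)).map fun x => .swap (m + a - 1 - x)

/-- A superposition in which, between punctures, all the strands of `b` run below those of `a`;
`m` is the number of strands of `b`. The flag says whether `a` is the upper word. -/
def plan (up : Bool) : ℕ → ℕ → List Slice → List Slice → List WeaveStep
  | 0, _, _, _ => []
  | fuel + 1, m, a, s :: b =>
    bif s.kind.isPuncture then
      match a with
      | [] => []
      | r :: a =>
        bif r.kind.isPuncture then
          swaps m s.pos r.pos ++ .puncture (s.pos + r.pos) :: (swaps m s.pos r.pos).reverse ++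
            plan up fuel m a b
        else (if up then .upper r.kind (m + r.pos) else .lower r.kind (m + r.pos)) ::
          plan up fuel m a (s :: b)
    else (if up then .lower s.kind s.pos else .upper s.kind s.pos) ::
      plan up fuel (m - s.kind.ins + s.kind.outs) a b
  | fuel + 1, m, r :: a, [] =>
    (if up then .upper r.kind (m + r.pos) else .lower r.kind (m + r.pos)) :: plan up fuel m a []
  | _ + 1, _, [], [] => []

/-- The superposition obtained by following `l`, if `l` fits the words `w₁` and `w₂`. -/
def superpose (w₁ w₂ : List Slice) (l : List WeaveStep) : Option (List Slice) :=
  match weave [] l with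
  | none => none
  | some r => bif sameWord r.1 w₁ && sameWord r.2.1 w₂ then some r.2.2 else none

/-- The list of steps is merely a certificate: it is replayed by `weave` and the two words it
produces are compared with the given ones. Hence nothing has to be proved about `plan` and `swaps`.
-/
theorem superposed_of_superpose {w₁ w₂ w : List Slice} {l : List WeaveStep}
    (h : superpose w₁ w₂ l = some w) : Superposed [] w₁ w₂ w := by
  simp only [superpose] at h
  split at h
  · simp at h
  · rename_i r hr
    cases h' : sameWord r.1 w₁ && sameWord r.2.1 w₂
    · simp [h'] at h
    · rw [h', cond_true, Option.some.injEq] at h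
      rw [Bool.and_eq_true] at h'
      obtain rfl := eq_of_sameWord h'.1
      obtain rfl := eq_of_sameWord h'.2
      subst h
      exact superposed_of_weave hr

/-- The number of crossings of a word. -/
def crossings (w : List Slice) : ℕ :=
  w.countP fun s => match s.kind with
    | .cross _ => true
    | _ => false

/-- A superposition of two words with few crossings. -/
def stack (w₁ w₂ : List Slice) : Option (List Slice) :=
  match superpose w₁ w₂ (plan true (w₁.length + w₂.length) 0 w₁ w₂),
      superpose w₁ w₂ (plan false (w₁.length + w₂.length) 0 w₂ w₁) with
  | some w, some w' =>
    forceWord (cancelCrossings w) fun v => forceWord (cancelCrossings w') fun v' =>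
      bif (crossings v).ble (crossings v') then some v else some v'
  | _, _ => none

theorem stack_eq {w₁ w₂ w : List Slice} (h : stack w₁ w₂ = some w) :
    ∃ v, Superposed [] w₁ w₂ v ∧ Simplify v 0 w := by
  simp only [stack] at h
  split at h
  · rename_i v v' hv hv'
    simp only [forceWord_eq] at h
    cases h' : (crossings (cancelCrossings v)).ble (crossings (cancelCrossings v')) <;>
      simp only [h', cond_true, cond_false] at h
    · exact ⟨v', superposed_of_superpose hv', Option.some.inj h ▸ simplify_cancelCrossings v'⟩
    · exact ⟨v, superposed_of_superpose hv, Option.some.inj h ▸ simplify_cancelCrossings v⟩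
  · simp at h

/-! ### Formal combinations of words -/

/-- A linear combination of words: the triple `(k, e, w)` stands for `k A ^ e w`. -/
abbrev Combination : Type := List (ℤ × ℤ × List Slice)

namespace Combination

/-- `force T k = k T`, evaluating the coefficients and exponents of `T` to literals. -/
def force {α : Type*} : Combination → (Combination → α) → α
  | [], k => k []
  | x :: T, k =>
    forceInt x.1 fun a => forceInt x.2.1 fun e => force T fun T => k ((a, e, x.2.2) :: T)

@[simp] theorem force_eq {α : Type*} (T : Combination) (k : Combination → α) :
    force T k = k T := by
  induction T generalizing k with
  | nil => rfl
  | cons x T ih => simp [force, ih]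

/-- Add `k A ^ e` to a Laurent polynomial, given as a list of coefficients and exponents. -/
def insertMonomial (k e : ℤ) : List (ℤ × ℤ) → List (ℤ × ℤ)
  | [] => [(k, e)]
  | x :: p => bif decide (x.2 = e) then (x.1 + k, e) :: p else x :: insertMonomial k e p

/-- A search tree of words, ordered by their codes, with coefficients. -/
inductive Tree : Type
  | leaf : Tree
  | node (code : ℕ) (w : List Slice) (p : List (ℤ × ℤ)) (l r : Tree) : Tree

/-- Add the term `k A ^ e w` to a tree. -/
def Tree.insert (k e : ℤ) (code : ℕ) (w : List Slice) : Tree → Tree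
  | .leaf => .node code w [(k, e)] .leaf .leaf
  | .node c v p l r =>
    bif code.blt c then .node c v p (l.insert k e code w) r
    else bif code.beq c && sameWord v w then .node c v (insertMonomial k e p) l r
    else .node c v p l (r.insert k e code w)

/-- The terms of a tree. -/
def Tree.toList : Tree → Combination
  | .leaf => []
  | .node _ w p l r => p.map (fun x => (x.1, x.2, w)) ++ (l.toList ++ r.toList)

/-- A numerical code for words. -/
def wordCode (w : List Slice) : ℕ := w.foldl (fun c s => 64 * c + s.code) 0

/-- Collect equal terms. -/
def collect (T : Combination) : Combination :=
  (T.foldr (fun x S => forceNat (wordCode x.2.2) fun c => S.insert x.1 x.2.1 c x.2.2)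
    Tree.leaf).toList

/-- Multiply by a scalar `k A ^ e`. -/
def scale (k e : ℤ) (T : Combination) : Combination := T.map fun x => (k * x.1, e + x.2.1, x.2.2)

/-- Multiply by a power of `-(A ^ 2 + A ^ (-2))`. -/
def circles : ℕ → Combination → Combination
  | 0, T => T
  | c + 1, T => circles c (scale (-1) 2 T ++ scale (-1) (-2) T)

/-- Resolve all the crossings of a word. -/
def resolve : List Slice → Combination
  | [] => [(1, 0, [])]
  | s :: w =>
    match s.kind with
    | .cross f =>
      (resolve w).flatMap fun x =>
        [(x.1, x.2.1 + (if f then 1 else -1), cap s.pos :: cup s.pos :: x.2.2),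
          (x.1, x.2.1 + (if f then -1 else 1), x.2.2)]
    | _ => (resolve w).map fun x => (x.1, x.2.1, s :: x.2.2)

/-- Bring the words of a combination into normal form. -/
def tighten (T : Combination) : Combination :=
  T.flatMap fun x => Skein.tighten 20 x.2.2 fun c w => circles c [(x.1, x.2.1, w)]

/-- The product of a word with a combination. -/
def mulWord (k e : ℤ) (w : List Slice) : Combination → Option Combination
  | [] => some []
  | x :: T =>
    match stack w x.2.2, mulWord k e w T with
    | some v, some S => some (scale (k * x.1) (e + x.2.1) (tighten (resolve v)) ++ S)
    | _, _ => none

/-- The product of two combinations. -/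
def mul : Combination → Combination → Option Combination
  | [], _ => some []
  | x :: S, T =>
    match mulWord x.1 x.2.1 x.2.2 T, mul S T with
    | some U, some V => some (U ++ V)
    | _, _ => none

variable {R : Type*} [CommRing R] {A : Rˣ} {n : ℕ}

variable (R A n) in
/-- The element of the skein algebra represented by a combination. -/
noncomputable def eval (T : Combination) : SkeinAlgebra R A n :=
  (T.map fun x => ((x.1 : R) * ((A ^ x.2.1 : Rˣ) : R)) • bracket R A n x.2.2).sum

@[simp] theorem eval_nil : eval R A n [] = 0 := rfl

theorem eval_cons (x : ℤ × ℤ × List Slice) (T : Combination) :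
    eval R A n (x :: T) =
      ((x.1 : R) * ((A ^ x.2.1 : Rˣ) : R)) • bracket R A n x.2.2 + eval R A n T := by
  simp [eval]

@[simp] theorem eval_append (S T : Combination) :
    eval R A n (S ++ T) = eval R A n S + eval R A n T := by
  simp [eval]

theorem eval_insertMonomial (k e : ℤ) (p : List (ℤ × ℤ)) (w : List Slice) :
    eval R A n ((insertMonomial k e p).map fun x => (x.1, x.2, w)) =
      ((k : R) * ((A ^ e : Rˣ) : R)) • bracket R A n w +
        eval R A n (p.map fun x => (x.1, x.2, w)) := by
  induction p with
  | nil => simp [insertMonomial, eval_cons]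
  | cons x p ih =>
    simp only [insertMonomial]
    cases h : decide (x.2 = e)
    · rw [cond_false, List.map_cons, eval_cons, ih, List.map_cons, eval_cons]
      abel
    · obtain rfl := of_decide_eq_true h
      simp only [cond_true, List.map_cons, eval_cons, Int.cast_add]
      module

/-- Whichever branch is taken, the term is added exactly once, so neither an ordering invariant of
the tree nor injectivity of the word code is required; terms are merged only after the words have
been compared. -/
theorem eval_insert (k e : ℤ) (c : ℕ) (w : List Slice) (T : Tree) :
    eval R A n (T.insert k e c w).toList =
      ((k : R) * ((A ^ e : Rˣ) : R)) • bracket R A n w + eval R A n T.toList := by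
  induction T with
  | leaf => simp [Tree.insert, Tree.toList, eval_cons]
  | node d v p l r ihl ihr =>
    simp only [Tree.insert]
    cases c.blt d
    · cases h : (c.beq d && sameWord v w)
      · simp only [cond_false, Tree.toList, eval_append, ihr]
        abel
      · rw [Bool.and_eq_true] at h
        obtain rfl := eq_of_sameWord h.2
        simp only [cond_false, cond_true, Tree.toList, eval_append, eval_insertMonomial]
        abel
    · simp only [cond_true, Tree.toList, eval_append, ihl]
      abel

theorem eval_collect (T : Combination) : eval R A n (collect T) = eval R A n T := by
  induction T with
  | nil => rfl
  | cons x T ih =>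
    rw [eval_cons, ← ih]
    simp only [collect, List.foldr_cons, forceNat_eq, eval_insert]

theorem eval_scale (k e : ℤ) (T : Combination) :
    eval R A n (scale k e T) = ((k : R) * ((A ^ e : Rˣ) : R)) • eval R A n T := by
  induction T with
  | nil => simp [scale]
  | cons x T ih =>
    rw [eval_cons, smul_add, ← ih, smul_smul]
    simp only [scale, List.map_cons, eval_cons, Int.cast_mul, zpow_add, Units.val_mul]
    congr 2
    ring

theorem eval_circles (c : ℕ) (T : Combination) :
    eval R A n (circles c T) = (-((A : R) ^ 2 + ((A⁻¹ : Rˣ) : R) ^ 2)) ^ c • eval R A n T := by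
  induction c generalizing T with
  | zero => simp [circles]
  | succ c ih =>
    rw [circles, ih, eval_append, eval_scale, eval_scale, ← add_smul, smul_smul, pow_succ]
    congr 2
    have e : ((A ^ (-2 : ℤ) : Rˣ) : R) = ((A⁻¹ : Rˣ) : R) ^ 2 := by
      rw [← Units.val_pow_eq_pow_val, zpow_neg, ← inv_zpow]; rfl
    have e' : ((A ^ (2 : ℤ) : Rˣ) : R) = (A : R) ^ 2 := by
      rw [← Units.val_pow_eq_pow_val]; rfl
    rw [e, e']
    push_cast
    ring

/-- A tail of a word is not a diagram and has no bracket of its own. The prefix `u` therefore stays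
arbitrary in the induction, and absorbs the events already treated. -/
theorem eval_resolve {w u : List Slice} (h : Closes 0 (u ++ w)) :
    bracket R A n (u ++ w) = eval R A n ((resolve w).map fun x => (x.1, x.2.1, u ++ x.2.2)) := by
  induction w generalizing u with
  | nil => simp [resolve, eval_cons]
  | cons s w ih =>
    by_cases hs : ∃ f, s.kind = .cross f
    · obtain ⟨k, p⟩ := s
      obtain ⟨f, rfl⟩ := hs
      obtain ⟨h1, h2⟩ := closes_smoothing h
      have i1 := ih (u := u ++ [cap p, cup p]) (by simpa using h1)
      have i2 := ih h2
      simp only [List.append_assoc, List.cons_append, List.nil_append] at i1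
      have := bracket_cross (A := A) (n := n) h
      rw [i1, i2] at this
      refine this.trans ?_
      simp only [resolve]
      generalize resolve w = T
      induction T with
      | nil => simp
      | cons x T ih' =>
        simp only [List.map_cons, eval_cons, List.flatMap_cons, List.map_append, eval_append,
          List.map_nil, eval_nil, smul_add, add_zero, ← ih', smul_smul, zpow_add, Units.val_mul]
        module
    · have i := ih (u := u ++ [s]) (by simpa using h)
      simp only [List.append_assoc, List.cons_append, List.nil_append] at i
      rw [i]
      have e : resolve (s :: w) = (resolve w).map fun x => (x.1, x.2.1, s :: x.2.2) := by
        obtain ⟨k, p⟩ := s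
        cases k with
        | cross f => exact absurd ⟨f, rfl⟩ hs
        | _ => rfl
      rw [e, List.map_map]
      rfl

theorem closes_resolve {w u : List Slice} (h : Closes 0 (u ++ w)) :
    ∀ x ∈ resolve w, Closes 0 (u ++ x.2.2) := by
  induction w generalizing u with
  | nil => simpa [resolve] using h
  | cons s w ih =>
    by_cases hs : ∃ f, s.kind = .cross f
    · obtain ⟨k, p⟩ := s
      obtain ⟨f, rfl⟩ := hs
      obtain ⟨h1, h2⟩ := closes_smoothing h
      have i1 := ih (u := u ++ [cap p, cup p]) (by simpa using h1)
      have i2 := ih h2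
      intro x hx
      simp only [resolve, List.mem_flatMap, List.mem_cons, List.not_mem_nil, or_false] at hx
      obtain ⟨y, hy, rfl | rfl⟩ := hx
      · simpa using i1 y hy
      · exact i2 y hy
    · have i := ih (u := u ++ [s]) (by simpa using h)
      have e : resolve (s :: w) = (resolve w).map fun x => (x.1, x.2.1, s :: x.2.2) := by
        obtain ⟨k, p⟩ := s
        cases k with
        | cross f => exact absurd ⟨f, rfl⟩ hs
        | _ => rfl
      intro x hx
      rw [e] at hx
      obtain ⟨y, hy, rfl⟩ := List.mem_map.1 hx
      simpa using i y hy

theorem eval_tighten {T : Combination} (h : ∀ x ∈ T, Closes 0 x.2.2) :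
    eval R A n (tighten T) = eval R A n T := by
  induction T with
  | nil => rfl
  | cons x T ih =>
    obtain ⟨c, w, hs, hk⟩ := exists_tighten 20 x.2.2
    have := ih fun y hy => h y (by simp [hy])
    rw [tighten] at this
    rw [tighten, List.flatMap_cons, hk, eval_append, eval_circles, this, eval_cons, eval_cons,
      eval_nil, add_zero, hs.bracket_eq (h x (by simp)), smul_smul, smul_smul, mul_comm]

/-- Here multiplication becomes computation: the product is any superposition, and every
superposition expands into crossingless words. -/
theorem eval_stack {w₁ w₂ w : List Slice} (h : stack w₁ w₂ = some w) :
    eval R A n (tighten (resolve w)) = bracket R A n w₁ * bracket R A n w₂ := by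
  obtain ⟨v, hv, hs⟩ := stack_eq h
  have hc := hs.closes hv.closes.2.2
  rw [eval_tighten (closes_resolve (u := []) hc), bracket_mul hv,
    hs.bracket_eq hv.closes.2.2, pow_zero, one_smul]
  simpa using (eval_resolve (R := R) (A := A) (n := n) (u := []) hc).symm

theorem eval_mulWord {k e : ℤ} {w : List Slice} {T S : Combination}
    (h : mulWord k e w T = some S) :
    eval R A n S = (((k : R) * ((A ^ e : Rˣ) : R)) • bracket R A n w) * eval R A n T := by
  induction T generalizing S with
  | nil =>
    simp only [mulWord, Option.some.injEq] at h
    simp [← h]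
  | cons x T ih =>
    simp only [mulWord] at h
    split at h
    · rename_i v U hv hU
      simp only [Option.some.injEq] at h
      rw [← h, eval_append, eval_scale, eval_stack hv, ih hU, eval_cons, mul_add,
        smul_mul_smul_comm]
      simp only [Int.cast_mul, zpow_add, Units.val_mul]
      congr 2
      ring
    · simp at h

theorem eval_mul {S T U : Combination} (h : mul S T = some U) :
    eval R A n U = eval R A n S * eval R A n T := by
  induction S generalizing U with
  | nil =>
    simp only [mul, Option.some.injEq] at h
    simp [← h]
  | cons x S ih =>
    simp only [mul] at h
    split at h
    · rename_i V W hV hW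
      simp only [Option.some.injEq] at h
      rw [← h, eval_append, eval_mulWord hV, ih hW, eval_cons, add_mul]
    · simp at h

end Combination

/-! ### Formal expressions -/

/-- Formal expressions in the curves `t_I` and Laurent monomials in `A`. -/
inductive Expression (n : ℕ) : Type
  | one : Expression n
  | curve (I : Finset (Fin n)) : Expression n
  | add (x y : Expression n) : Expression n
  | mul (x y : Expression n) : Expression n
  | smul (k e : ℤ) (x : Expression n) : Expression n

namespace Expression

variable {n : ℕ}

/-- The element of the skein algebra given by an expression. -/
noncomputable def eval {R : Type*} [CommRing R] (A : Rˣ) : Expression n → SkeinAlgebra R A n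
  | one => 1
  | curve I => t A I
  | add x y => x.eval A + y.eval A
  | mul x y => x.eval A * y.eval A
  | smul k e x => ((k : R) * ((A ^ e : Rˣ) : R)) • x.eval A

/-- The normal form of an expression. -/
def normalize : Expression n → Option Combination
  | one => some [(1, 0, List.replicate n (puncture 0))]
  | curve I => forceWord (Skein.curve I).word fun w => some [(1, 0, w)]
  | add x y =>
    match x.normalize, y.normalize with
    | some S, some T => (Combination.collect (S ++ T)).force some
    | _, _ => none
  | mul x y =>
    match x.normalize, y.normalize with
    | some S, some T =>
      match Combination.mul S T with
      | some U => U.force fun U => U.collect.force some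
      | none => none
    | _, _ => none
  | smul k e x =>
    match x.normalize with
    | some S => (Combination.scale k e S).force some
    | none => none

theorem eval_normalize {R : Type*} [CommRing R] {A : Rˣ} {x : Expression n} {T : Combination}
    (h : x.normalize = some T) : x.eval A = T.eval R A n := by
  induction x generalizing T with
  | one =>
    simp only [normalize, Option.some.injEq] at h
    subst h
    simp [eval, Combination.eval_cons, bracket_empty]
  | curve I =>
    simp only [normalize, forceWord_eq, Option.some.injEq] at h
    subst h
    simp [eval, Combination.eval_cons, bracket_word, t]
  | add x y ihx ihy =>
    simp only [normalize] at h
    split at h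
    · rename_i S U hS hU
      simp only [Combination.force_eq, Option.some.injEq] at h
      rw [← h, Combination.eval_collect, Combination.eval_append, eval, ihx hS, ihy hU]
    · simp at h
  | mul x y ihx ihy =>
    simp only [normalize] at h
    split at h
    · rename_i S U hS hU
      split at h
      · rename_i V hV
        simp only [Combination.force_eq, Option.some.injEq] at h
        rw [← h, Combination.eval_collect, Combination.eval_mul hV, eval, ihx hS, ihy hU]
      · simp at h
    · simp at h
  | smul k e x ih =>
    simp only [normalize] at h
    split at h
    · rename_i S hS
      simp only [Combination.force_eq, Option.some.injEq] at h
      rw [← h, Combination.eval_scale, eval, ih hS]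
    · simp at h

/-- Whether the normal form of an expression is zero. -/
def isZero (x : Expression n) : Bool :=
  match x.normalize with
  | some T => T.all fun y => decide (y.1 = 0)
  | none => false

/-- Formal cancellation over the integers implies vanishing in every skein algebra, so a single
computation serves all `R` and `A`. -/
theorem eval_eq_zero {R : Type*} [CommRing R] {A : Rˣ} {x : Expression n}
    (h : x.isZero = true) : x.eval A = (0 : SkeinAlgebra R A n) := by
  simp only [isZero] at h
  split at h
  · rename_i T hT
    rw [eval_normalize hT]
    clear hT
    induction T with
    | nil => rfl
    | cons y T ih =>
      simp only [List.all_cons, Bool.and_eq_true, decide_eq_true_eq] at h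
      rw [Combination.eval_cons, ih h.2, h.1]
      simp
  · simp at h

/-- `α x`, where `α = A ^ 2 + A ^ (-2)`. -/
def alpha (x : Expression n) : Expression n := add (smul 1 2 x) (smul 1 (-2) x)

/-- `α s_{ij}`. -/
def s₂ (i j : Fin n) : Expression n :=
  if i = j then add (alpha (alpha one)) (smul (-1) 0 (mul (curve {i}) (curve {i})))
  else add (alpha (curve {i, j})) (mul (curve {i}) (curve {j}))

/-- `α² s_{ijk}`. -/
def s₃ (i j k : Fin n) : Expression n :=
  add (add (alpha (alpha (curve {i, j, k})))
    (alpha (add (add (mul (curve {i}) (curve {j, k})) (mul (curve {j}) (curve {i, k})))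
      (mul (curve {k}) (curve {i, j})))))
    (smul 2 0 (mul (mul (curve {i}) (curve {j})) (curve {k})))

/-- The expression `x - y`. -/
def sub (x y : Expression n) : Expression n := add x (smul (-1) 0 y)

/-- The difference of the two sides of the five-index relation, multiplied by `α³`. -/
def fiveIndex (i : Fin 5 → Fin n) : Expression n :=
  sub
    (sub (add (sub (smul 1 4 (mul (s₂ (i 0) (i 4)) (s₃ (i 1) (i 2) (i 3))))
            (mul (s₂ (i 1) (i 4)) (s₃ (i 0) (i 2) (i 3))))
          (mul (s₂ (i 2) (i 4)) (s₃ (i 0) (i 1) (i 3))))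
        (smul 1 (-4) (mul (s₂ (i 3) (i 4)) (s₃ (i 0) (i 1) (i 2)))))
    (sub (smul 1 2
        (add (smul 1 (-2) (mul (s₂ (i 0) (i 1)) (s₃ (i 2) (i 3) (i 4))))
          (smul 1 2 (mul (s₂ (i 2) (i 3)) (s₃ (i 0) (i 1) (i 4))))))
      (smul 1 (-2)
        (add (smul 1 (-2) (mul (s₂ (i 0) (i 1)) (s₃ (i 2) (i 3) (i 4))))
          (smul 1 2 (mul (s₂ (i 2) (i 3)) (s₃ (i 0) (i 1) (i 4)))))))

/-- The term multiplied by `(q - q⁻¹)²` in the four-index relation. -/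
def fourIndexCorrection (i : Fin 4 → Fin n) : Expression n :=
  mul (curve {i 0})
    (sub (sub (mul (s₂ (i 0) (i 2)) (s₂ (i 1) (i 3)))
        (smul 1 4 (mul (s₂ (i 0) (i 1)) (s₂ (i 2) (i 3)))))
      (smul 1 (-4) (mul (s₂ (i 0) (i 3)) (s₂ (i 1) (i 2)))))

/-- The difference of the two sides of the four-index relation, multiplied by `α³`. -/
def fourIndex (i : Fin 4 → Fin n) : Expression n :=
  sub
    (sub (add (sub (smul 1 4 (mul (s₂ (i 0) (i 1)) (s₃ (i 0) (i 2) (i 3))))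
            (mul (s₂ (i 0) (i 2)) (s₃ (i 0) (i 1) (i 3))))
          (smul 1 (-4) (mul (s₂ (i 0) (i 3)) (s₃ (i 0) (i 1) (i 2)))))
        (sub (add (smul 1 4 (mul (s₂ (i 0) (i 0)) (s₃ (i 1) (i 2) (i 3))))
            (smul 1 (-4) (mul (s₂ (i 0) (i 0)) (s₃ (i 1) (i 2) (i 3)))))
          (mul (s₂ (i 0) (i 0)) (s₃ (i 1) (i 2) (i 3)))))
    (sub (add (smul 1 4 (fourIndexCorrection i)) (smul 1 (-4) (fourIndexCorrection i)))
      (smul 2 0 (fourIndexCorrection i)))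

/-! ### The relations on disks with five, four and two punctures. -/

set_option maxRecDepth 10000 in
-- The computational core. No rotational symmetry of the word model is available, so each of the
-- five rotations is verified separately.
theorem fiveIndex_isZero (v : Fin 5) :
    (fiveIndex fun k : Fin 5 => k + v).isZero = true := by
  revert v
  decide +kernel

set_option maxRecDepth 10000 in
theorem fourIndex_isZero (v : Fin 4) :
    (fourIndex fun k : Fin 4 => k + v).isZero = true := by
  revert v
  decide +kernel

theorem commute_isZero :
    (sub (mul (curve {(0 : Fin 2)}) (curve {1})) (mul (curve {1}) (curve {0}))).isZero = true := by
  decide +kernel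

end Expression

/-! ### Inserting a puncture above a diagram -/

theorem width_cons (m : ℕ) (s : Slice) (u : List Slice) :
    width m (s :: u) = width (m - s.kind.ins + s.kind.outs) u := rfl

/-- Insert a puncture above all the strands, immediately after the `j`-th puncture of a word
starting with `m` strands. -/
def insertPuncture : ℕ → ℕ → List Slice → List Slice
  | 0, m, w => puncture m :: w
  | _ + 1, m, [] => [puncture m]
  | j + 1, m, s :: w =>
    s :: insertPuncture (if s.kind = .puncture then j else j + 1) (m - s.kind.ins + s.kind.outs) w

@[simp] theorem insertPuncture_zero (m : ℕ) (w : List Slice) :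
    insertPuncture 0 m w = puncture m :: w := by
  cases w <;> rfl

theorem closes_insertPuncture {j m : ℕ} {w : List Slice} (h : Closes m w) :
    Closes m (insertPuncture j m w) := by
  induction w generalizing j m with
  | nil => cases j <;> simpa [insertPuncture, Closes, puncture, Kind.ins, Kind.outs] using h
  | cons s w ih =>
    cases j with
    | zero => exact ⟨le_rfl, h⟩
    | succ j => exact ⟨h.1, ih h.2⟩

/-- A puncture above all strands slides freely past every event except another puncture. Only its
rank among the punctures matters, not its exact place in the word. -/
theorem simplify_insertPuncture {j m : ℕ} {u v : List Slice} (h : Closes m (u ++ v))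
    (hj : punctureCount u = j) :
    Simplify (insertPuncture j m (u ++ v)) 0 (u ++ puncture (width m u) :: v) := by
  induction u generalizing j m with
  | nil =>
    subst hj
    exact insertPuncture_zero m v ▸ .refl _
  | cons s u ih =>
    have ih' {j} := ih (j := j) h.2
    rw [punctureCount_cons] at hj
    split_ifs at hj with hs
    · obtain rfl : j = punctureCount u + 1 := by omega
      simpa only [List.cons_append, insertPuncture, if_pos hs, width_cons] using (ih' rfl).cons s
    · rw [zero_add] at hj
      cases j with
      | zero =>
        obtain ⟨d, hd⟩ := Nat.exists_eq_add_of_le h.1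
        subst hd
        have := Shrink.exchange' s.kind .puncture s.pos d (by simp [hs])
        refine .head this (.cons s ?_)
        have := ih' hj
        have e : s.pos + s.kind.ins + d - s.kind.ins + s.kind.outs =
          s.pos + s.kind.outs + d := by omega
        rw [insertPuncture_zero, e] at this
        rwa [width_cons, e]
      | succ j =>
        simpa only [List.cons_append, insertPuncture, if_neg hs, width_cons] using (ih' hj).cons s

theorem exists_split {j : ℕ} {w : List Slice} (h : j ≤ punctureCount w) :
    ∃ u v, w = u ++ v ∧ punctureCount u = j := by
  induction w generalizing j with
  | nil => exact ⟨[], [], rfl, (Nat.le_zero.1 h).symm⟩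
  | cons s w ih =>
    rw [punctureCount_cons] at h
    by_cases hj : j = 0
    · exact ⟨[], _, rfl, hj.symm⟩
    · obtain ⟨u, v, rfl, hu⟩ := ih (j := j - if s.kind = .puncture then 1 else 0) (by omega)
      refine ⟨s :: u, v, rfl, ?_⟩
      rw [punctureCount_cons, hu]
      split_ifs <;> omega

section

variable {R : Type*} [CommRing R] {A : Rˣ} {n : ℕ}

theorem bracket_insertPuncture {u v : List Slice} (h : Closes 0 (u ++ v)) :
    Closes 0 (u ++ puncture (width 0 u) :: v) ∧
      bracket R A n (insertPuncture (punctureCount u) 0 (u ++ v)) =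
        bracket R A n (u ++ puncture (width 0 u) :: v) := by
  have hs := simplify_insertPuncture h rfl
  have hc := closes_insertPuncture (j := punctureCount u) h
  exact ⟨hs.closes hc, by rw [hs.bracket_eq hc, pow_zero, one_smul]⟩

variable (R A n) in
/-- A puncture can be inserted outside of the part of a diagram where a local move takes place. -/
theorem exists_context {j : ℕ} {u v x : List Slice} (hx : Closes 0 (u ++ x ++ v))
    (hc : punctureCount x ≤ 1) (hj : j ≤ punctureCount (u ++ x ++ v)) :
    ∃ u' v', ∀ y, Closes 0 (u ++ y ++ v) → punctureCount y = punctureCount x →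
      Closes 0 (u' ++ y ++ v') ∧
        bracket R A n (insertPuncture j 0 (u ++ y ++ v)) = bracket R A n (u' ++ y ++ v') := by
  -- As `x` has at most one puncture, the new one can always be placed before `x` or after it, never
  -- inside.
  by_cases h : j ≤ punctureCount u
  · obtain ⟨u₁, u₂, rfl, rfl⟩ := exists_split h
    refine ⟨u₁ ++ puncture (width 0 u₁) :: u₂, v, fun y hy _ => ?_⟩
    simp only [List.append_assoc, List.cons_append] at hy ⊢
    exact bracket_insertPuncture hy
  · simp only [punctureCount_append] at hj
    obtain ⟨v₁, v₂, rfl, hv⟩ := exists_split (j := j - punctureCount (u ++ x)) (w := v)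
      (by simp only [punctureCount_append]; omega)
    refine ⟨u, v₁ ++ puncture (width 0 (u ++ x ++ v₁)) :: v₂, fun y hy hyc => ?_⟩
    -- Both prefixes are followed by the same closing remainder, so the new puncture sits at the
    -- same height in the two diagrams.
    have e : width 0 (u ++ x ++ v₁) = width 0 (u ++ y ++ v₁) := by
      rw [← List.append_assoc, closes_append] at hx hy
      exact hx.2.unique hy.2
    have hj' : j = punctureCount (u ++ y ++ v₁) := by
      simp only [punctureCount_append] at hv ⊢
      omega
    rw [e, hj']
    have := bracket_insertPuncture (R := R) (A := A) (n := n) (u := u ++ y ++ v₁) (v := v₂)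
      (by simpa using hy)
    simpa only [List.append_assoc] using this

theorem LocalMove.punctureCount {x y : List Slice} (h : LocalMove x y) :
    punctureCount x = punctureCount y ∧ punctureCount x ≤ 1 := by
  cases h with
  | exchange g h i d hgh =>
    refine ⟨by simp [punctureCount_cons, add_comm], ?_⟩
    simp only [punctureCount_cons, punctureCount_nil]
    split_ifs with h1 h2
    · exact absurd ⟨h1, h2⟩ hgh
    all_goals simp
  | _ => simp [punctureCount_cons, cup, cap, cross]

theorem insertPuncture_replicate (j n : ℕ) :
    insertPuncture j 0 (List.replicate n (puncture 0)) =
      List.replicate (n + 1) (puncture 0) := by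
  induction n generalizing j with
  | zero => cases j <;> rfl
  | succ n ih =>
    cases j with
    | zero => rfl
    | succ j =>
      rw [List.replicate_succ, insertPuncture]
      exact congrArg _ (ih j)

theorem Superposed.insertPuncture_zero {c : List Bool} {w₁ w₂ w : List Slice}
    (h : Superposed c w₁ w₂ w) :
    Superposed c (insertPuncture 0 (c.count true) w₁) (insertPuncture 0 (c.count false) w₂)
      (insertPuncture 0 c.length w) := by
  have := Superposed.puncture c [] w₁ w₂ w (by rwa [List.append_nil])
  simpa only [Skein.insertPuncture_zero, List.append_nil] using this

/-- A puncture above all strands of a superposition is above all strands of each factor, so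
insertion commutes with stacking. This gives multiplicativity of `insertHom`. -/
theorem Superposed.insertPuncture {c : List Bool} {w₁ w₂ w : List Slice}
    (h : Superposed c w₁ w₂ w) (j : ℕ) :
    Superposed c (insertPuncture j (c.count true) w₁) (insertPuncture j (c.count false) w₂)
      (insertPuncture j c.length w) := by
  induction h generalizing j with
  | nil => cases j <;> exact .puncture [] [] _ _ _ .nil
  | upper a b k hk w₁ w₂ w h ih =>
    cases j with
    | zero => exact (Superposed.upper a b k hk _ _ _ h).insertPuncture_zero
    | succ j =>
      have := ih (j + 1)
      simp only [Skein.insertPuncture, if_neg hk]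
      refine Superposed.upper a b k hk _ _ _ ?_
      convert this using 2 <;>
        simp [List.count_append, List.count_replicate] <;> omega
  | lower a b k hk w₁ w₂ w h ih =>
    cases j with
    | zero => exact (Superposed.lower a b k hk _ _ _ h).insertPuncture_zero
    | succ j =>
      have := ih (j + 1)
      simp only [Skein.insertPuncture, if_neg hk]
      refine Superposed.lower a b k hk _ _ _ ?_
      convert this using 2 <;>
        simp [List.count_append, List.count_replicate] <;> omega
  | puncture a b w₁ w₂ w h ih =>
    cases j with
    | zero => exact (Superposed.puncture a b _ _ _ h).insertPuncture_zero
    | succ j => exact Superposed.puncture a b _ _ _ (ih j)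
  | upperRises a b w₁ w₂ w h ih =>
    cases j with
    | zero => exact (Superposed.upperRises a b _ _ _ h).insertPuncture_zero
    | succ j =>
      have := ih (j + 1)
      simp only [Skein.insertPuncture]
      refine Superposed.upperRises a b _ _ _ ?_
      convert this using 2 <;> simp [List.count_append, cross, Kind.ins, Kind.outs]; omega
  | lowerRises a b w₁ w₂ w h ih =>
    cases j with
    | zero => exact (Superposed.lowerRises a b _ _ _ h).insertPuncture_zero
    | succ j =>
      have := ih (j + 1)
      simp only [Skein.insertPuncture]
      refine Superposed.lowerRises a b _ _ _ ?_
      convert this using 2 <;> simp [List.count_append, cross, Kind.ins, Kind.outs]; omega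

variable (R A) in
/-- The homomorphism of skein algebras given by inserting a puncture above all diagrams, after the
`j`-th puncture. -/
noncomputable def insertHom (j : ℕ) (hj : j ≤ n) :
    SkeinAlgebra R A n →ₐ[R] SkeinAlgebra R A (n + 1) :=
  RingQuot.liftAlgHom R ⟨FreeAlgebra.lift R fun D =>
      bracket R A (n + 1) (insertPuncture j 0 D.word), by
    intro x y h
    cases h with
    | isotopy D D' u v x y hxy hD hD' =>
      have h1 := D.closes
      have h2 := D'.closes
      have h3 : punctureCount D.word = n := D.punctures
      simp only [FreeAlgebra.lift_ι_apply]
      rw [hD] at h1 h3 ⊢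
      rw [hD'] at h2 ⊢
      obtain ⟨u', v', H⟩ := exists_context R A (n + 1) (j := j) h1 hxy.punctureCount.2
        (by omega)
      obtain ⟨c1, e1⟩ := H x h1 rfl
      obtain ⟨c2, e2⟩ := H y h2 hxy.punctureCount.1.symm
      rw [e1, e2]
      exact bracket_localMove hxy c1 c2 hxy.punctureCount.1
    | skeinRising D D₁ D₂ u v i hD hD₁ hD₂ =>
      have h1 := D.closes
      have h2 := D₁.closes
      have h3 := D₂.closes
      have h4 : punctureCount D.word = n := D.punctures
      simp only [FreeAlgebra.lift_ι_apply, map_add, map_smul]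
      -- An empty middle segment makes the three diagrams differ only inside a common context.
      rw [show u ++ v = u ++ [] ++ v by simp] at hD₂
      rw [hD] at h1 h4 ⊢
      rw [hD₁] at h2 ⊢
      rw [hD₂] at h3 ⊢
      obtain ⟨u', v', H⟩ := exists_context R A (n + 1) (j := j) h1
        (by simp [punctureCount_cons, cross]) (by omega)
      obtain ⟨c1, e1⟩ := H _ h1 rfl
      obtain ⟨c2, e2⟩ := H _ h2 (by simp [punctureCount_cons, cross, cap, cup])
      obtain ⟨c3, e3⟩ := H _ h3 (by simp [punctureCount_cons, cross])
      rw [e1, e2, e3]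
      simp only [List.append_assoc, List.cons_append, List.nil_append] at c1 ⊢
      simpa using bracket_cross (A := A) (n := n + 1) c1
    | skeinDescending D D₁ D₂ u v i hD hD₁ hD₂ =>
      have h1 := D.closes
      have h2 := D₁.closes
      have h3 := D₂.closes
      have h4 : punctureCount D.word = n := D.punctures
      simp only [FreeAlgebra.lift_ι_apply, map_add, map_smul]
      rw [show u ++ v = u ++ [] ++ v by simp] at hD₁
      rw [hD] at h1 h4 ⊢
      rw [hD₁] at h2 ⊢
      rw [hD₂] at h3 ⊢
      obtain ⟨u', v', H⟩ := exists_context R A (n + 1) (j := j) h1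
        (by simp [punctureCount_cons, cross]) (by omega)
      obtain ⟨c1, e1⟩ := H _ h1 rfl
      obtain ⟨c2, e2⟩ := H _ h2 (by simp [punctureCount_cons, cross])
      obtain ⟨c3, e3⟩ := H _ h3 (by simp [punctureCount_cons, cross, cap, cup])
      rw [e1, e2, e3]
      simp only [List.append_assoc, List.cons_append, List.nil_append] at c1 ⊢
      rw [add_comm (_ • _)]
      simpa using bracket_cross (A := A) (n := n + 1) c1
    | circle D D' u v i hD hD' =>
      have h1 := D.closes
      have h2 := D'.closes
      have h4 : punctureCount D.word = n := D.punctures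
      simp only [FreeAlgebra.lift_ι_apply, map_smul]
      rw [show u ++ v = u ++ [] ++ v by simp] at hD'
      rw [hD] at h1 h4 ⊢
      rw [hD'] at h2 ⊢
      obtain ⟨u', v', H⟩ := exists_context R A (n + 1) (j := j) h1
        (by simp [punctureCount_cons, cup, cap]) (by omega)
      obtain ⟨c1, e1⟩ := H _ h1 rfl
      obtain ⟨c2, e2⟩ := H _ h2 (by simp [punctureCount_cons, cap, cup])
      rw [e1, e2]
      simp only [List.append_assoc, List.cons_append, List.nil_append] at c1 c2 ⊢
      exact bracket_circle c1 c2
    | empty D hD =>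
      rw [FreeAlgebra.lift_ι_apply, hD, insertPuncture_replicate, bracket_empty, map_one]
    | stack D₁ D₂ D h =>
      simp only [FreeAlgebra.lift_ι_apply, map_mul]
      exact bracket_mul (h.insertPuncture j)⟩

theorem insertHom_t (j : ℕ) (hj : j ≤ n) (I : Finset (Fin n)) :
    insertHom R A j hj (t A I) = bracket R A (n + 1) (insertPuncture j 0 (curve I).word) := by
  rw [insertHom, t, RingQuot.liftAlgHom_mkAlgHom_apply, FreeAlgebra.lift_ι_apply]

theorem finRange_succAbove (j : Fin (n + 1)) :
    List.finRange (n + 1) = ((List.finRange n).take j).map j.succAbove ++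
      j :: ((List.finRange n).drop j).map j.succAbove := by
  have hj : (j : ℕ) ≤ n := Nat.lt_succ_iff.1 j.2
  apply List.ext_getElem
  · simp; omega
  · intro k h1 h2
    rw [List.getElem_append]
    split_ifs with h
    · simp only [List.length_map, List.length_take, List.length_finRange] at h
      have hk : k < (j : ℕ) := by omega
      ext
      simp only [List.getElem_finRange, List.getElem_map, List.getElem_take]
      rw [Fin.succAbove_of_castSucc_lt _ _ (by simpa [Fin.lt_def] using hk)]
      simp
    · simp only [List.length_map, List.length_take, List.length_finRange,
        min_eq_left hj] at h ⊢
      rw [List.getElem_cons]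
      split_ifs with h'
      · ext
        simp only [List.getElem_finRange]
        simp; omega
      · ext
        simp only [List.getElem_finRange, List.getElem_map, List.getElem_drop]
        rw [Fin.succAbove_of_le_castSucc _ _ (by simp [Fin.le_def])]
        simp
        omega

theorem curveAt_image_succAbove (j : Fin (n + 1)) (I : Finset (Fin n)) (k : Fin n) :
    curveAt (I.image j.succAbove) (j.succAbove k) = curveAt I k := by
  simp [curveAt, strandsBelow, Fin.succAbove_le_succAbove_iff, Fin.succAbove_lt_succAbove_iff]

theorem mem_drop_finRange {j : ℕ} {k : Fin n} : k ∈ (List.finRange n).drop j ↔ j ≤ k := by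
  rw [List.mem_drop_iff_getElem]
  constructor
  · rintro ⟨i, hi, rfl⟩
    simp
  · intro h
    exact ⟨k - j, by simp; omega, by ext; simp; omega⟩

/-- This is where the convention that `t_I` passes below the punctures it omits is used: the new
puncture, lying above everything, is exactly such an omitted puncture. -/
theorem curve_succAbove (j : Fin (n + 1)) (I : Finset (Fin n)) :
    bracket R A (n + 1) (insertPuncture j 0 (curve I).word) = t A (I.image j.succAbove) := by
  have hj : (j : ℕ) ≤ n := Nat.lt_succ_iff.1 j.2
  set u := ((List.finRange n).take j).flatMap (curveAt I) with hu
  set v := ((List.finRange n).drop j).flatMap (curveAt I) with hv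
  have hw : (curve I).word = u ++ v := by
    rw [hu, hv, ← List.flatMap_append, List.take_append_drop]
    rfl
  have hcu : punctureCount u = j := by
    rw [hu, punctureCount, countP_curve]
    simpa using hj
  have hc : Closes 0 (u ++ v) := hw ▸ (curve I).closes
  have hv' := closes_curve I ((List.finRange n).drop j)
    ((List.pairwise_lt_finRange n).sublist (List.drop_sublist _ _)) (by
      intro a ha b hb
      rw [mem_drop_finRange] at ha hb
      exact Fin.lt_def.2 (by omega))
  rw [t, ← bracket_word, hw, ← hcu, (bracket_insertPuncture hc).2]
  congr 1
  -- The height is two if `I` has punctures on both sides of the insertion point, and zero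
  -- otherwise, which is `strandsBelow` at the new puncture.
  rw [(closes_append.1 hc).2.unique hv']
  change _ = (List.finRange (n + 1)).flatMap _
  rw [finRange_succAbove j, List.flatMap_append, List.flatMap_cons, List.flatMap_map,
    List.flatMap_map]
  simp only [curveAt_image_succAbove]
  rw [← hu, ← hv]
  congr 1
  have e1 : ∀ a : Fin n, j.succAbove a < j ↔ a ∉ (List.finRange n).drop j := by
    intro a
    rw [mem_drop_finRange, Fin.succAbove_lt_iff_castSucc_lt, Fin.lt_def, Fin.val_castSucc, not_le]
  have e2 : ∀ a : Fin n, j < j.succAbove a ↔ a ∈ (List.finRange n).drop j := by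
    intro a
    rw [mem_drop_finRange, Fin.lt_succAbove_iff_le_castSucc, Fin.le_def, Fin.val_castSucc]
  simp [curveAt, strandsBelow, e1, e2, Fin.succAbove_ne]

end

/-- An increasing map of punctures induces a homomorphism of skein algebras. -/
theorem exists_algHom {R : Type*} [CommRing R] (A : Rˣ) {m n : ℕ} (a : Fin m → Fin n)
    (ha : StrictMono a) :
    ∃ f : SkeinAlgebra R A m →ₐ[R] SkeinAlgebra R A n, ∀ I, f (t A I) = t A (I.image a) := by
  induction n with
  | zero =>
    have hm : m = 0 := by
      by_contra h
      exact (a ⟨0, Nat.pos_of_ne_zero h⟩).elim0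
    subst hm
    exact ⟨AlgHom.id R _, fun I => by simp [Subsingleton.elim a id]⟩
  | succ n ih =>
    -- A surjective increasing map is the identity. Otherwise it misses some `j` and factors through
    -- `j.succAbove`, and the insertion of one puncture applies.
    by_cases hs : Function.Surjective a
    · obtain rfl : m = n + 1 := by
        simpa using Fintype.card_congr (Equiv.ofBijective a ⟨ha.injective, hs⟩)
      have : a = id := by
        have := Subsingleton.elim (StrictMono.orderIsoOfSurjective a ha hs) (OrderIso.refl _)
        ext k
        exact congrArg Fin.val (DFunLike.congr_fun this k)
      exact ⟨AlgHom.id R _, fun I => by simp [this]⟩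
    · obtain ⟨j, hj⟩ := not_forall.1 hs
      choose b hb using fun k => Fin.exists_succAbove_eq (fun h : a k = j => hj ⟨k, h⟩)
      have hb' : StrictMono b := fun k l h => by
        rw [← Fin.succAbove_lt_succAbove_iff (p := j), hb, hb]
        exact ha h
      obtain ⟨f, hf⟩ := ih b hb'
      refine ⟨(insertHom R A j (Nat.lt_succ_iff.1 j.2)).comp f, fun I => ?_⟩
      rw [AlgHom.comp_apply, hf, insertHom_t, curve_succAbove, Finset.image_image]
      congr 2
      exact funext hb

/-! ### From the formal computations to the relations for arbitrary punctures. -/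

section Relations

variable {R : Type*} [CommRing R] {A : Rˣ} {β : R} {n : ℕ}

theorem val_zpow_ofNat (m : ℕ) : ((A ^ (m : ℤ) : Rˣ) : R) = (A : R) ^ m := by
  rw [zpow_natCast, Units.val_pow_eq_pow_val]

theorem val_zpow_neg_ofNat (m : ℕ) : ((A ^ (-(m : ℤ)) : Rˣ) : R) = ((A⁻¹ : Rˣ) : R) ^ m := by
  rw [zpow_neg, zpow_natCast, ← inv_pow, Units.val_pow_eq_pow_val]

namespace Expression

theorem eval_sub (x y : Expression n) :
    (sub x y).eval A = (x.eval A - y.eval A : SkeinAlgebra R A n) := by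
  simp only [sub, eval, Int.cast_neg, Int.cast_one, zpow_zero, Units.val_one, mul_one]
  module

theorem eval_alpha (x : Expression n) :
    (alpha x).eval A =
      ((A : R) ^ 2 + ((A⁻¹ : Rˣ) : R) ^ 2) • (x.eval A : SkeinAlgebra R A n) := by
  have h1 := val_zpow_ofNat (A := A) 2
  have h2 := val_zpow_neg_ofNat (A := A) 2
  push_cast at h1 h2
  simp only [alpha, eval, h1, h2, Int.cast_one, one_mul, add_smul]

end Expression

/-- Since `β` inverts `α`, the formal expressions can be cleared of denominators and the powers of
`β` restored afterwards. -/
theorem s₂_eq (hβ : ((A : R) ^ 2 + ((A⁻¹ : Rˣ) : R) ^ 2) * β = 1) (i j : Fin n) :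
    s₂ A β i j = β • (Expression.s₂ i j).eval A := by
  unfold s₂ Expression.s₂
  have h1 (x : SkeinAlgebra R A n) :
      β • ((A : R) ^ 2 + ((A⁻¹ : Rˣ) : R) ^ 2) • x = x := by
    rw [smul_smul, mul_comm, hβ, one_smul]
  split_ifs with h
  · simp only [Expression.eval, Expression.eval_alpha, smul_add, h1, Algebra.algebraMap_eq_smul_one,
      zpow_zero, Units.val_one, mul_one, Int.cast_neg, Int.cast_one, sq (t A {i})]
    module
  · simp only [Expression.eval, Expression.eval_alpha, smul_add, h1]

theorem s₃_eq (hβ : ((A : R) ^ 2 + ((A⁻¹ : Rˣ) : R) ^ 2) * β = 1) (i j k : Fin n) :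
    s₃ A β i j k = β ^ 2 • (Expression.s₃ i j k).eval A := by
  have h1 (x : SkeinAlgebra R A n) :
      β • ((A : R) ^ 2 + ((A⁻¹ : Rˣ) : R) ^ 2) • x = x := by
    rw [smul_smul, mul_comm, hβ, one_smul]
  simp only [s₃, Expression.s₃, Expression.eval, Expression.eval_alpha, smul_add, sq β, mul_smul,
    h1, zpow_zero, Units.val_one, mul_one, Int.cast_ofNat]
  rw [smul_comm β (2 : R), smul_comm β (2 : R)]

theorem s₂_mul_s₃ (hβ : ((A : R) ^ 2 + ((A⁻¹ : Rˣ) : R) ^ 2) * β = 1) (i j k l m : Fin n) :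
    s₂ A β i j * s₃ A β k l m =
      β ^ 3 • ((Expression.s₂ i j).eval A * (Expression.s₃ k l m).eval A) := by
  rw [s₂_eq hβ, s₃_eq hβ, smul_mul_smul_comm, ← pow_succ']

theorem s₂_mul_s₂ (hβ : ((A : R) ^ 2 + ((A⁻¹ : Rˣ) : R) ^ 2) * β = 1) (i j k l : Fin n) :
    s₂ A β i j * s₂ A β k l =
      β ^ 2 • ((Expression.s₂ i j).eval A * (Expression.s₂ k l).eval A) := by
  rw [s₂_eq hβ, s₂_eq hβ, smul_mul_smul_comm, ← sq]

theorem fiveIndex_relation (hβ : ((A : R) ^ 2 + ((A⁻¹ : Rˣ) : R) ^ 2) * β = 1) (i : Fin 5 → Fin n)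
    (hi : (Expression.fiveIndex i).isZero = true) :
    (A : R) ^ 4 • (s₂ A β (i 0) (i 4) * s₃ A β (i 1) (i 2) (i 3))
        - s₂ A β (i 1) (i 4) * s₃ A β (i 0) (i 2) (i 3)
        + s₂ A β (i 2) (i 4) * s₃ A β (i 0) (i 1) (i 3)
        - ((A⁻¹ : Rˣ) : R) ^ 4 • (s₂ A β (i 3) (i 4) * s₃ A β (i 0) (i 1) (i 2))
      = ((A : R) ^ 2 - ((A⁻¹ : Rˣ) : R) ^ 2) •
          (((A⁻¹ : Rˣ) : R) ^ 2 • (s₂ A β (i 0) (i 1) * s₃ A β (i 2) (i 3) (i 4))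
            + (A : R) ^ 2 • (s₂ A β (i 2) (i 3) * s₃ A β (i 0) (i 1) (i 4))) := by
  have h := Expression.eval_eq_zero (R := R) (A := A) hi
  have h1 := val_zpow_ofNat (A := A) 2
  have h2 := val_zpow_neg_ofNat (A := A) 2
  have h3 := val_zpow_ofNat (A := A) 4
  have h4 := val_zpow_neg_ofNat (A := A) 4
  push_cast at h1 h2 h3 h4
  simp only [Expression.fiveIndex, Expression.eval_sub, Expression.eval,
    h1, h2, h3, h4, Int.cast_one, one_mul] at h
  simp only [s₂_mul_s₃ hβ]
  linear_combination (norm := module) (β ^ 3) • h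

theorem fourIndex_relation (hβ : ((A : R) ^ 2 + ((A⁻¹ : Rˣ) : R) ^ 2) * β = 1) (i : Fin 4 → Fin n)
    (hi : (Expression.fourIndex i).isZero = true) :
    (A : R) ^ 4 • (s₂ A β (i 0) (i 1) * s₃ A β (i 0) (i 2) (i 3))
        - s₂ A β (i 0) (i 2) * s₃ A β (i 0) (i 1) (i 3)
        + ((A⁻¹ : Rˣ) : R) ^ 4 • (s₂ A β (i 0) (i 3) * s₃ A β (i 0) (i 1) (i 2))
        - ((A : R) ^ 4 + ((A⁻¹ : Rˣ) : R) ^ 4 - 1) •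
            (s₂ A β (i 0) (i 0) * s₃ A β (i 1) (i 2) (i 3))
      = (((A : R) ^ 2 - ((A⁻¹ : Rˣ) : R) ^ 2) ^ 2 * β) •
          (t A {i 0} *
            (s₂ A β (i 0) (i 2) * s₂ A β (i 1) (i 3)
              - (A : R) ^ 4 • (s₂ A β (i 0) (i 1) * s₂ A β (i 2) (i 3))
              - ((A⁻¹ : Rˣ) : R) ^ 4 • (s₂ A β (i 0) (i 3) * s₂ A β (i 1) (i 2)))) := by
  have h := Expression.eval_eq_zero (R := R) (A := A) hi
  have h3 := val_zpow_ofNat (A := A) 4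
  have h4 := val_zpow_neg_ofNat (A := A) 4
  push_cast at h3 h4
  -- The formal expression contains this factor in expanded form, as three monomials.
  have hc : ((A : R) ^ 2 - ((A⁻¹ : Rˣ) : R) ^ 2) ^ 2 = (A : R) ^ 4 + ((A⁻¹ : Rˣ) : R) ^ 4 - 2 := by
    have : (A : R) * ((A⁻¹ : Rˣ) : R) = 1 := A.mul_inv
    linear_combination (-2 * ((A : R) * ((A⁻¹ : Rˣ) : R)) - 2) * this
  simp only [Expression.fourIndex, Expression.fourIndexCorrection, Expression.eval_sub,
    Expression.eval,
    h3, h4, Int.cast_one, one_mul, Int.cast_ofNat, zpow_zero, Units.val_one, mul_one] at h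
  simp only [s₂_mul_s₃ hβ, s₂_mul_s₂ hβ, hc, mul_sub, mul_smul_comm] at h ⊢
  -- On the left, `β³` comes from one `s₂` and one `s₃`; on the right, from two `s₂` and the
  -- explicit `β`.
  linear_combination (norm := module) (β ^ 3) • h

theorem map_s₂ {m : ℕ} {a : Fin m → Fin n} (ha : StrictMono a)
    {f : SkeinAlgebra R A m →ₐ[R] SkeinAlgebra R A n} (hf : ∀ I, f (t A I) = t A (I.image a))
    (i j : Fin m) : f (s₂ A β i j) = s₂ A β (a i) (a j) := by
  simp only [s₂, ha.injective.eq_iff]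
  split_ifs <;> simp [hf, Finset.image_insert]

theorem map_s₃ {m : ℕ} {a : Fin m → Fin n}
    {f : SkeinAlgebra R A m →ₐ[R] SkeinAlgebra R A n} (hf : ∀ I, f (t A I) = t A (I.image a))
    (i j k : Fin m) : f (s₃ A β i j k) = s₃ A β (a i) (a j) (a k) := by
  simp [s₃, hf, Finset.image_insert]

/-- Loops around different punctures can be made disjoint; this too is computed on the smallest
disk, with two punctures, and transported. -/
theorem t_mul_comm (i j : Fin n) : t A {i} * t A {j} = t A {j} * t A {i} := by
  have key : ∀ i j : Fin n, i < j → t A {i} * t A {j} = t A {j} * t A {i} := by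
    intro i j hij
    obtain ⟨f, hf⟩ := exists_algHom A ![i, j] (by
      rw [Fin.strictMono_iff_lt_succ]
      intro k
      fin_cases k
      exact hij)
    have h := Expression.eval_eq_zero (R := R) (A := A) Expression.commute_isZero
    rw [Expression.eval_sub, sub_eq_zero] at h
    simpa [Expression.eval, hf] using congrArg f h
  rcases lt_trichotomy i j with h | rfl | h
  · exact key i j h
  · rfl
  · exact (key j i h).symm

theorem s₂_comm (i j : Fin n) : s₂ A β i j = s₂ A β j i := by
  by_cases h : i = j
  · rw [h]
  · rw [s₂, s₂, if_neg h, if_neg (Ne.symm h), Finset.pair_comm, t_mul_comm]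

theorem s₃_rotate (i j k : Fin n) : s₃ A β j k i = s₃ A β i j k := by
  have e : ({j, k, i} : Finset (Fin n)) = {i, j, k} := by
    ext x; simp only [Finset.mem_insert, Finset.mem_singleton]; tauto
  rw [s₃, s₃, e, Finset.pair_comm k i, Finset.pair_comm j i,
    show t A {j} * t A {k} * t A {i} = t A {i} * t A {j} * t A {k} by
      rw [mul_assoc, t_mul_comm k i, ← mul_assoc, t_mul_comm j i]]
  congr 3
  abel

theorem fiveIndex_cyclic (hβ : ((A : R) ^ 2 + ((A⁻¹ : Rˣ) : R) ^ 2) * β = 1) {a : Fin 5 → Fin n}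
    (ha : StrictMono a) (v : Fin 5) (i : Fin 5 → Fin n) (hi : ∀ k, i k = a (k + v)) :
    (A : R) ^ 4 • (s₂ A β (i 0) (i 4) * s₃ A β (i 1) (i 2) (i 3))
        - s₂ A β (i 1) (i 4) * s₃ A β (i 0) (i 2) (i 3)
        + s₂ A β (i 2) (i 4) * s₃ A β (i 0) (i 1) (i 3)
        - ((A⁻¹ : Rˣ) : R) ^ 4 • (s₂ A β (i 3) (i 4) * s₃ A β (i 0) (i 1) (i 2))
      = ((A : R) ^ 2 - ((A⁻¹ : Rˣ) : R) ^ 2) •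
          (((A⁻¹ : Rˣ) : R) ^ 2 • (s₂ A β (i 0) (i 1) * s₃ A β (i 2) (i 3) (i 4))
            + (A : R) ^ 2 • (s₂ A β (i 2) (i 3) * s₃ A β (i 0) (i 1) (i 4))) := by
  obtain ⟨f, hf⟩ := exists_algHom A a ha
  have h := congrArg f (fiveIndex_relation hβ _ (Expression.fiveIndex_isZero v))
  simpa only [map_sub, map_add, map_smul, map_mul, map_s₂ ha hf, map_s₃ hf, ← hi] using h

theorem fourIndex_cyclic (hβ : ((A : R) ^ 2 + ((A⁻¹ : Rˣ) : R) ^ 2) * β = 1) {a : Fin 4 → Fin n}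
    (ha : StrictMono a) (v : Fin 4) (i : Fin 4 → Fin n) (hi : ∀ k, i k = a (k + v)) :
    (A : R) ^ 4 • (s₂ A β (i 0) (i 1) * s₃ A β (i 0) (i 2) (i 3))
        - s₂ A β (i 0) (i 2) * s₃ A β (i 0) (i 1) (i 3)
        + ((A⁻¹ : Rˣ) : R) ^ 4 • (s₂ A β (i 0) (i 3) * s₃ A β (i 0) (i 1) (i 2))
        - ((A : R) ^ 4 + ((A⁻¹ : Rˣ) : R) ^ 4 - 1) •
            (s₂ A β (i 0) (i 0) * s₃ A β (i 1) (i 2) (i 3))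
      = (((A : R) ^ 2 - ((A⁻¹ : Rˣ) : R) ^ 2) ^ 2 * β) •
          (t A {i 0} *
            (s₂ A β (i 0) (i 2) * s₂ A β (i 1) (i 3)
              - (A : R) ^ 4 • (s₂ A β (i 0) (i 1) * s₂ A β (i 2) (i 3))
              - ((A⁻¹ : Rˣ) : R) ^ 4 • (s₂ A β (i 0) (i 3) * s₂ A β (i 1) (i 2)))) := by
  obtain ⟨f, hf⟩ := exists_algHom A a ha
  have h := congrArg f (fourIndex_relation hβ _ (Expression.fourIndex_isZero v))
  simpa only [map_sub, map_add, map_smul, map_mul, map_s₂ ha hf, map_s₃ hf, hf,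
    Finset.image_singleton, ← hi] using h

end Relations

/-- Powers of the basic rotation are translations of `Fin (m + 1)`, the form in which the
computations were carried out. -/
theorem CyclicOrder.exists_shift {m n : ℕ} {i : Fin (m + 1) → Fin n} (h : CyclicOrder i) :
    ∃ a : Fin (m + 1) → Fin n, StrictMono a ∧ ∃ v, ∀ k, i k = a (k + v) := by
  obtain ⟨a, ha, v, rfl⟩ := h
  have key : ∃ c, ∀ k, (finRotate (m + 1) ^ v) k = k + c := by
    induction v with
    | zero => exact ⟨0, fun k => by simp⟩
    | succ v ih =>
      obtain ⟨c, hc⟩ := ih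
      exact ⟨c + 1, fun k => by
        rw [pow_succ', Equiv.Perm.mul_apply, hc, finRotate_apply, add_assoc]⟩
  obtain ⟨c, hc⟩ := key
  exact ⟨a, ha, c, fun k => congrArg a (hc k)⟩

/-! ### The classical type II relations at `q² = 1`. -/

section Classical

variable {R : Type*} [CommRing R] {A : Rˣ} {β : R} {n : ℕ}

theorem strictMono_four {a₁ a₂ a₃ a₄ : Fin n} (h₁ : a₁ < a₂) (h₂ : a₂ < a₃) (h₃ : a₃ < a₄) :
    StrictMono ![a₁, a₂, a₃, a₄] := by
  rw [Fin.strictMono_iff_lt_succ]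
  intro k
  fin_cases k <;> assumption

theorem strictMono_five {a₁ a₂ a₃ a₄ a₅ : Fin n} (h₁ : a₁ < a₂) (h₂ : a₂ < a₃) (h₃ : a₃ < a₄)
    (h₄ : a₄ < a₅) : StrictMono ![a₁, a₂, a₃, a₄, a₅] := by
  rw [Fin.strictMono_iff_lt_succ]
  intro k
  fin_cases k <;> assumption

/-- There are nine positions of `c` relative to the `a_j`. When `c` is distinct from them, the
rotation in the five-index relation is chosen so that `c` comes last; when `c` is one of them, the
rotation in the four-index relation puts `c` first. The results agree with the claim up to a global
sign and the order of the indices. -/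
theorem classical_relation (hβ : ((A : R) ^ 2 + ((A⁻¹ : Rˣ) : R) ^ 2) * β = 1)
    (hA : (A : R) ^ 4 = 1) {c a₁ a₂ a₃ a₄ : Fin n} (h₁ : a₁ < a₂) (h₂ : a₂ < a₃) (h₃ : a₃ < a₄) :
    s₂ A β a₁ c * s₃ A β a₂ a₃ a₄ - s₂ A β a₂ c * s₃ A β a₁ a₃ a₄
      + s₂ A β a₃ c * s₃ A β a₁ a₂ a₄ - s₂ A β a₄ c * s₃ A β a₁ a₂ a₃ = 0 := by
  have hAi : (A : R) * ((A⁻¹ : Rˣ) : R) = 1 := A.mul_inv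
  have hA' : ((A⁻¹ : Rˣ) : R) ^ 4 = 1 := by
    have : ((A : R) * ((A⁻¹ : Rˣ) : R)) ^ 4 = 1 := by rw [hAi, one_pow]
    rwa [mul_pow, hA, one_mul] at this
  -- Thus `q = q⁻¹`: the right-hand sides of both quantum relations disappear, including the term
  -- with `β t_i`.
  have hq : (A : R) ^ 2 - ((A⁻¹ : Rˣ) : R) ^ 2 = 0 := by
    have : (A : R) ^ 4 * ((A⁻¹ : Rˣ) : R) ^ 2 = (A : R) ^ 2 := by
      linear_combination ((A : R) ^ 3 * ((A⁻¹ : Rˣ) : R) + (A : R) ^ 2) * hAi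
    rw [hA, one_mul] at this
    rw [this, sub_self]
  have five : ∀ {a : Fin 5 → Fin n}, StrictMono a → ∀ v : Fin 5,
      s₂ A β (a (0 + v)) (a (4 + v)) * s₃ A β (a (1 + v)) (a (2 + v)) (a (3 + v))
        - s₂ A β (a (1 + v)) (a (4 + v)) * s₃ A β (a (0 + v)) (a (2 + v)) (a (3 + v))
        + s₂ A β (a (2 + v)) (a (4 + v)) * s₃ A β (a (0 + v)) (a (1 + v)) (a (3 + v))
        - s₂ A β (a (3 + v)) (a (4 + v)) * s₃ A β (a (0 + v)) (a (1 + v)) (a (2 + v)) = 0 := by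
    intro a ha v
    have := fiveIndex_cyclic hβ ha v _ fun k => rfl
    simpa only [hA, hA', hq, one_smul, zero_smul] using this
  have four : ∀ v : Fin 4, ∀ {a : Fin 4 → Fin n}, a = ![a₁, a₂, a₃, a₄] →
      s₂ A β (a (0 + v)) (a (1 + v)) * s₃ A β (a (0 + v)) (a (2 + v)) (a (3 + v))
        - s₂ A β (a (0 + v)) (a (2 + v)) * s₃ A β (a (0 + v)) (a (1 + v)) (a (3 + v))
        + s₂ A β (a (0 + v)) (a (3 + v)) * s₃ A β (a (0 + v)) (a (1 + v)) (a (2 + v))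
        - s₂ A β (a (0 + v)) (a (0 + v)) * s₃ A β (a (1 + v)) (a (2 + v)) (a (3 + v)) = 0 := by
    intro v a ha
    have := fourIndex_cyclic hβ (ha ▸ strictMono_four h₁ h₂ h₃) v _ fun k => rfl
    -- The coefficient `q² + q⁻² - 1` becomes `1 + 1 - 1 = 1`.
    simpa only [hA, hA', hq, one_smul, zero_smul, zero_pow two_ne_zero, zero_mul,
      add_sub_cancel_right] using this
  have e (i j k : Fin n) : s₃ A β j k i = s₃ A β i j k := s₃_rotate i j k
  rcases lt_trichotomy c a₁ with h | rfl | h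
  · exact five (strictMono_five h h₁ h₂ h₃) 1
  · have := four 0 rfl
    change s₂ A β c a₂ * s₃ A β c a₃ a₄ - s₂ A β c a₃ * s₃ A β c a₂ a₄
      + s₂ A β c a₄ * s₃ A β c a₂ a₃ - s₂ A β c c * s₃ A β a₂ a₃ a₄ = 0 at this
    rw [s₂_comm a₂, s₂_comm a₃, s₂_comm a₄]
    linear_combination (norm := module) -this
  rcases lt_trichotomy c a₂ with h' | rfl | h'
  · have := five (strictMono_five h h' h₂ h₃) 2
    change s₂ A β a₂ c * s₃ A β a₃ a₄ a₁ - s₂ A β a₃ c * s₃ A β a₂ a₄ a₁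
      + s₂ A β a₄ c * s₃ A β a₂ a₃ a₁ - s₂ A β a₁ c * s₃ A β a₂ a₃ a₄ = 0 at this
    rw [e a₁ a₃ a₄, e a₁ a₂ a₄, e a₁ a₂ a₃] at this
    linear_combination (norm := module) -this
  · have := four 1 rfl
    change s₂ A β c a₃ * s₃ A β c a₄ a₁ - s₂ A β c a₄ * s₃ A β c a₃ a₁
      + s₂ A β c a₁ * s₃ A β c a₃ a₄ - s₂ A β c c * s₃ A β a₃ a₄ a₁ = 0 at this
    rw [e a₁ a₃ a₄, e a₁ c a₄, e a₁ c a₃] at this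
    rw [s₂_comm a₁, s₂_comm a₃, s₂_comm a₄]
    linear_combination (norm := module) this
  rcases lt_trichotomy c a₃ with h'' | rfl | h''
  · have := five (strictMono_five h₁ h' h'' h₃) 3
    change s₂ A β a₃ c * s₃ A β a₄ a₁ a₂ - s₂ A β a₄ c * s₃ A β a₃ a₁ a₂
      + s₂ A β a₁ c * s₃ A β a₃ a₄ a₂ - s₂ A β a₂ c * s₃ A β a₃ a₄ a₁ = 0 at this
    rw [← e a₄ a₁ a₂, ← e a₃ a₁ a₂, e a₂ a₃ a₄, e a₁ a₃ a₄] at this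
    linear_combination (norm := module) this
  · have := four 2 rfl
    change s₂ A β c a₄ * s₃ A β c a₁ a₂ - s₂ A β c a₁ * s₃ A β c a₄ a₂
      + s₂ A β c a₂ * s₃ A β c a₄ a₁ - s₂ A β c c * s₃ A β a₄ a₁ a₂ = 0 at this
    rw [← e c a₁ a₂, e a₂ c a₄, e a₁ c a₄, ← e a₄ a₁ a₂] at this
    rw [s₂_comm a₁, s₂_comm a₂, s₂_comm a₄]
    linear_combination (norm := module) -this
  rcases lt_trichotomy c a₄ with h''' | rfl | h'''
  · have := five (strictMono_five h₁ h₂ h'' h''') 4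
    change s₂ A β a₄ c * s₃ A β a₁ a₂ a₃ - s₂ A β a₁ c * s₃ A β a₄ a₂ a₃
      + s₂ A β a₂ c * s₃ A β a₄ a₁ a₃ - s₂ A β a₃ c * s₃ A β a₄ a₁ a₂ = 0 at this
    rw [← e a₄ a₂ a₃, ← e a₄ a₁ a₃, ← e a₄ a₁ a₂] at this
    linear_combination (norm := module) -this
  · have := four 3 rfl
    change s₂ A β c a₁ * s₃ A β c a₂ a₃ - s₂ A β c a₂ * s₃ A β c a₁ a₃
      + s₂ A β c a₃ * s₃ A β c a₁ a₂ - s₂ A β c c * s₃ A β a₁ a₂ a₃ = 0 at this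
    rw [← e c a₂ a₃, ← e c a₁ a₃, ← e c a₁ a₂] at this
    rw [s₂_comm a₁, s₂_comm a₂, s₂_comm a₃]
    exact this
  · exact five (strictMono_five h₁ h₂ h₃ h''') 0

end Classical

end Skein

theorem proposition4p8 {R : Type*} [CommRing R] (A : Rˣ) (q : Rˣ) (hq : q = A ^ 2)
    (β : R) (hβ : ((q : R) + ((q⁻¹ : Rˣ) : R)) * β = 1) (n : ℕ) :
    (∀ i₁ i₂ i₃ i₄ i₅ : Fin n, Skein.CyclicOrder ![i₁, i₂, i₃, i₄, i₅] →
      (q : R) ^ 2 • (Skein.s₂ A β i₁ i₅ * Skein.s₃ A β i₂ i₃ i₄)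
          - Skein.s₂ A β i₂ i₅ * Skein.s₃ A β i₁ i₃ i₄
          + Skein.s₂ A β i₃ i₅ * Skein.s₃ A β i₁ i₂ i₄
          - ((q⁻¹ : Rˣ) : R) ^ 2 • (Skein.s₂ A β i₄ i₅ * Skein.s₃ A β i₁ i₂ i₃)
        = ((q : R) - ((q⁻¹ : Rˣ) : R)) •
            (((q⁻¹ : Rˣ) : R) • (Skein.s₂ A β i₁ i₂ * Skein.s₃ A β i₃ i₄ i₅)
              + (q : R) • (Skein.s₂ A β i₃ i₄ * Skein.s₃ A β i₁ i₂ i₅))) ∧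
    (∀ i₁ i₂ i₃ i₄ : Fin n, Skein.CyclicOrder ![i₁, i₂, i₃, i₄] →
      (q : R) ^ 2 • (Skein.s₂ A β i₁ i₂ * Skein.s₃ A β i₁ i₃ i₄)
          - Skein.s₂ A β i₁ i₃ * Skein.s₃ A β i₁ i₂ i₄
          + ((q⁻¹ : Rˣ) : R) ^ 2 • (Skein.s₂ A β i₁ i₄ * Skein.s₃ A β i₁ i₂ i₃)
          - ((q : R) ^ 2 + ((q⁻¹ : Rˣ) : R) ^ 2 - 1) •
              (Skein.s₂ A β i₁ i₁ * Skein.s₃ A β i₂ i₃ i₄)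
        = (((q : R) - ((q⁻¹ : Rˣ) : R)) ^ 2 * β) •
            (Skein.t A {i₁} *
              (Skein.s₂ A β i₁ i₃ * Skein.s₂ A β i₂ i₄
                - (q : R) ^ 2 • (Skein.s₂ A β i₁ i₂ * Skein.s₂ A β i₃ i₄)
                - ((q⁻¹ : Rˣ) : R) ^ 2 • (Skein.s₂ A β i₁ i₄ * Skein.s₂ A β i₂ i₃)))) ∧
    ((q : R) ^ 2 = 1 → ∀ c a₁ a₂ a₃ a₄ : Fin n, a₁ < a₂ → a₂ < a₃ → a₃ < a₄ →
      Skein.s₂ A β a₁ c * Skein.s₃ A β a₂ a₃ a₄ - Skein.s₂ A β a₂ c * Skein.s₃ A β a₁ a₃ a₄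
        + Skein.s₂ A β a₃ c * Skein.s₃ A β a₁ a₂ a₄
        - Skein.s₂ A β a₄ c * Skein.s₃ A β a₁ a₂ a₃ = 0) := by
  subst hq
  -- All powers of `q` are rewritten as powers of `A`, the form used in the preceding lemmas.
  simp only [← inv_pow, Units.val_pow_eq_pow_val, ← pow_mul] at hβ ⊢
  norm_num only at hβ ⊢
  refine ⟨fun i₁ i₂ i₃ i₄ i₅ h => ?_, fun i₁ i₂ i₃ i₄ h => ?_,
    fun hA c a₁ a₂ a₃ a₄ h₁ h₂ h₃ => Skein.classical_relation hβ hA h₁ h₂ h₃⟩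
  · obtain ⟨a, ha, v, hv⟩ := h.exists_shift
    exact Skein.fiveIndex_cyclic hβ ha v _ hv
  · obtain ⟨a, ha, v, hv⟩ := h.exists_shift
    exact Skein.fourIndex_cyclic hβ ha v _ hv
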